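/- **Notation.** Fix a positive integer $r$. Let $A=A_r$ be the ring generated by $\rho_0,\dots,\rho_r,\sigma_0,\dots,\sigma_r$ subject to $\rho_j\sigma_i=\delta_{ij}$ and $\sum_{i=0}^r\sigma_i\rho_i=1$. Modules are right modules, and endomorphisms of abelian groups act on the right. **Template.** Let $G$ be a countable torsion-free abelian group whose endomorphism ring is $A$; that is, $G$ is a right $A$-module and $a\mapsto(g\mapsto ga)$ is an isomorphism of $A$ onto $\operatorname{End}(G)$. Let $H$ be an $A$-module with a chain of submodules $0=B_0\subseteq B_1\subseteq\cdots$ and union $B=\bigcup_n B_n$ such that $G\cong H/B$ as $A$-modules and, for all $n\in\omega$, $H/B_n$ and $B_{n+1}/B_n$ are free $A$-modules of rank $\omega$. For each $n$ let $b_{n,i}\in B_{n+1}$ $(i\in\omega)$ be elements whose cosets form an $A$-basis of $B_{n+1}/B_n$. **Ladders.** Let $E\subseteq\omega_1$ be a stationary set of limit ordinals, and for $\delta\in E$ let $\eta_\delta:\omega\to\delta$ be strictly increasing with range cofinal in $\delta$ and disjoint from $E$. Suppose the system is tree-like: for all $\delta,\gamma\in E$ and $n,m\in\omega$, $\eta_\delta(n)=\eta_\gamma(m)$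 implies $m=n$ and $\eta_\delta(l)=\eta_\gamma(l)$ for all $l<n$. **The group $M$.** Define $A$-modules $M_\beta$ $(\beta<\omega_1)$ by induction: $M_0=0$; $M_\beta=\bigcup_{\alpha<\beta}M_\alpha$ for limit $\beta$; $M_{\alpha+1}=M_\alpha\oplus\bigoplus_{i\in\omega}x_{\alpha,i}A$, with each $x_{\alpha,i}A$ free on $x_{\alpha,i}$, if $\alpha\notin E$; and, if $\delta\in E$, $M_{\delta+1}$ is the pushout of $M_\delta\leftarrow B\hookrightarrow H$, where $B\to M_\delta$ is the $A$-homomorphism sending $b_{n,i}$ to $x_{\eta_\delta(n),i}$. Let $M=\bigcup_{\beta<\omega_1}M_\beta$. **Proposition.** The ring $A$, mapped to the ring $\operatorname{End}(M)$ of endomorphisms of the abelian group $M$ by $a\mapsto(m\mapsto ma)$, is algebraically closed in $\operatorname{End}(M)$: every finite set of ring equations in finitely many (non-commuting) variables with parameters from $A$ which has a solution in $\operatorname{End}(M)$ has a solution in $A$. -/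

import Mathlib

open scoped Ordinal

namespace KaplanskyTest

/-! ### The ring `A_r` -/

/-- The generators `ρ_0, …, ρ_r, σ_0, …, σ_r`. -/
inductive Gen (r : ℕ) : Type
  | rho (i : Fin (r + 1)) : Gen r
  | sigma (i : Fin (r + 1)) : Gen r

/-- The defining relations: `ρ_j σ_i = 1` if `i = j`, `ρ_j σ_i = 0` if `i ≠ j`, and
`∑ i, σ_i ρ_i = 1`. -/
inductive CornerRel (r : ℕ) : FreeAlgebra ℤ (Gen r) → FreeAlgebra ℤ (Gen r) → Prop
  | rho_sigma_same (i : Fin (r + 1)) :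
      CornerRel r (FreeAlgebra.ι ℤ (Gen.rho i) * FreeAlgebra.ι ℤ (Gen.sigma i)) 1
  | rho_sigma_ne (i j : Fin (r + 1)) (h : i ≠ j) :
      CornerRel r (FreeAlgebra.ι ℤ (Gen.rho j) * FreeAlgebra.ι ℤ (Gen.sigma i)) 0
  | sum_sigma_rho :
      CornerRel r
        (∑ i : Fin (r + 1), FreeAlgebra.ι ℤ (Gen.sigma i) * FreeAlgebra.ι ℤ (Gen.rho i)) 1

/-- The ring `A_r` freely generated by the `ρ_i`, `σ_i` subject to the relations above. -/
def CornerRing (r : ℕ) : Type := RingQuot (CornerRel r)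

noncomputable instance (r : ℕ) : Ring (CornerRing r) :=
  inferInstanceAs (Ring (RingQuot (CornerRel r)))

/-! ### Right modules and algebraic closedness

A right `A`-module is a `Module Aᵐᵒᵖ M`; endomorphisms are made to act on the right as well, so
that the endomorphism ring in which `A` acts is `(AddMonoid.End M)ᵐᵒᵖ`. -/

/-- The natural ring homomorphism from `A` to the ring of additive endomorphisms (acting on the
right) of a right `A`-module `M`; it sends `a` to the endomorphism `m ↦ m a`. -/
def actionHom (A : Type*) [Ring A] (M : Type*) [AddCommGroup M] [Module Aᵐᵒᵖ M] :
    A →+* (AddMonoid.End M)ᵐᵒᵖ :=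
  (RingHom.op (Module.toAddMonoidEnd Aᵐᵒᵖ M)).comp (RingEquiv.opOp A).toRingHom

theorem actionHom_apply (A : Type*) [Ring A] (M : Type*) [AddCommGroup M] [Module Aᵐᵒᵖ M]
    (a : A) (m : M) : (actionHom A M a).unop m = MulOpposite.op a • m := rfl

/-- `A` is algebraically closed in `S` (along `f : A → S`): every finite set of ring equations
`p = 0` in finitely many (noncommuting) variables with parameters from `A` that has a solution
in `S` has a solution in `A`. A ring polynomial with parameters in `A` and variables
`X_0, …, X_{n-1}` is an element of the free ring on the disjoint union of `A` and the variables;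
it is evaluated by sending the parameters to themselves. -/
def IsAlgClosedIn {A S : Type*} [Ring A] [Ring S] (f : A →+* S) : Prop :=
  ∀ (n : ℕ) (P : Finset (FreeAlgebra ℤ (A ⊕ Fin n))),
    (∃ s : Fin n → S, ∀ p ∈ P, FreeAlgebra.lift ℤ (Sum.elim (fun a => f a) s) p = 0) →
    ∃ t : Fin n → A, ∀ p ∈ P, FreeAlgebra.lift ℤ (Sum.elim (fun a => a) t) p = 0

/-! ### The countable template -/

/-- The data `H`, `B = ⋃ B_n`, `b_{n,i}` over the right `A`-module `G`: a chain
`0 = B_0 ⊆ B_1 ⊆ …` of submodules of `H` such that all `H / B_n` are free of rank `ω`, elements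
`b_{n,i}` of `B_{n+1}` whose cosets form a basis of `B_{n+1} / B_n`, and an isomorphism
`H / B ≅ G`. (Taking `n = 0` shows that `H` is free of rank `ω`; the `b_{n,i}` form a basis
of `B`, see `Template.linearIndependent_b`.) -/
structure Template (A : Type*) [Ring A] (H : Type*) [AddCommGroup H] [Module Aᵐᵒᵖ H]
    (G : Type*) [AddCommGroup G] [Module Aᵐᵒᵖ G] where
  /-- The chain of the `B_n`. -/
  Bn : ℕ → Submodule Aᵐᵒᵖ H
  Bn_zero : Bn 0 = ⊥
  Bn_mono : Monotone Bn
  free_quotient : ∀ n, Nonempty (Module.Basis ℕ Aᵐᵒᵖ (H ⧸ Bn n))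
  /-- The elements `b_{n,i}`. -/
  b : ℕ → ℕ → H
  b_mem : ∀ n i, b n i ∈ Bn (n + 1)
  b_linearIndependent : ∀ n, LinearIndependent Aᵐᵒᵖ fun i => (Bn n).mkQ (b n i)
  b_span : ∀ n, Submodule.span Aᵐᵒᵖ (Set.range fun i => (Bn n).mkQ (b n i)) =
    (Bn (n + 1)).map (Bn n).mkQ
  /-- The isomorphism `H / B ≅ G`, where `B` is the union of the `B_n`. -/
  iso : (H ⧸ (⨆ n, Bn n)) ≃ₗ[Aᵐᵒᵖ] G

/-! ### Ladder systems -/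

/-- The well-ordered set `ω₁`, whose elements are the countable ordinals. -/
abbrev OmegaOne : Type := (ω₁ : Ordinal.{0}).ToType

/-- A stationary set `E` of limit ordinals below `ω₁` with a tree-like ladder system
`η_δ : ω → δ` (`δ ∈ E`) whose ladders have ranges disjoint from `E`. -/
structure LadderSystem where
  E : Set OmegaOne
  stationary : IsStationary E
  limit : ∀ δ ∈ E, Order.IsSuccLimit δ
  /-- The ladders. -/
  η : E → ℕ → OmegaOne
  η_strictMono : ∀ δ, StrictMono (η δ)
  η_lt : ∀ δ n, η δ n < δ
  η_cofinal : ∀ (δ : E) (α : OmegaOne), α < δ → ∃ n, α ≤ η δ n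
  η_notMem : ∀ δ n, η δ n ∉ E
  treeLike : ∀ (δ γ : E) (n m : ℕ), η δ n = η γ m → m = n ∧ ∀ l < n, η δ l = η γ l

/-! ### The group `M`

`M` is the right `A`-module obtained from `0` by adjoining, in the `α`-th of `ω₁` steps, a free
module with basis `x_{α,i}` (`i ∈ ω`) if `α ∉ E`, and by forming, if `δ = α ∈ E`, the pushout of
`M_δ ← B → H`, where `B → M_δ` sends `b_{n,i}` to `x_{η_δ(n),i}`. It is defined here in one stroke
as the direct sum of all `x_{α,i} A` (`α ∉ E`) and of one copy of `H` for every `δ ∈ E`, modulo the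
relations identifying `b_{n,i}` in the `δ`-th copy of `H` with `x_{η_δ(n),i}`. That the stages
`M_β` satisfy the recursion is proved below. -/

section Construction

variable {A : Type*} [Ring A] {H : Type*} [AddCommGroup H] [Module Aᵐᵒᵖ H]
  {G : Type*} [AddCommGroup G] [Module Aᵐᵒᵖ G] (T : Template A H G) (L : LadderSystem)

/-- The submodule `B` of `H`. -/
def Template.B : Submodule Aᵐᵒᵖ H := ⨆ n, T.Bn n

variable (A H) in
/-- The direct sum of all `x_{α,i} A`, `α ∉ E`, and of copies of `H` indexed by `E`. -/
abbrev PreM : Type _ :=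
  (({α : OmegaOne // α ∉ L.E} × ℕ) →₀ Aᵐᵒᵖ) × (L.E →₀ H)

/-- The relators (`b_{n,i}` in the `δ`-th copy of `H`) `- x_{η_δ(n),i}`. -/
noncomputable def relator (t : L.E × ℕ × ℕ) : PreM A H L :=
  (- Finsupp.single (⟨L.η t.1 t.2.1, L.η_notMem t.1 t.2.1⟩, t.2.2) 1,
    Finsupp.single t.1 (T.b t.2.1 t.2.2))

/-- The submodule of relations. -/
noncomputable def relations : Submodule Aᵐᵒᵖ (PreM A H L) :=
  Submodule.span Aᵐᵒᵖ (Set.range (relator T L))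

/-- The group `M`, as a right `A`-module. -/
abbrev GroupM : Type _ := PreM A H L ⧸ relations T L

/-- The element `x_{α,i}` of `M`, for `α ∉ E`. -/
noncomputable def xElt (α : {α : OmegaOne // α ∉ L.E}) (i : ℕ) : GroupM T L :=
  (relations T L).mkQ (Finsupp.single (α, i) 1, 0)

/-- The map `θ_δ : H → M`, for `δ ∈ E`. -/
noncomputable def theta (δ : L.E) : H →ₗ[Aᵐᵒᵖ] GroupM T L :=
  (relations T L).mkQ ∘ₗ LinearMap.inr _ _ _ ∘ₗ Finsupp.lsingle δ

variable (A H) in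
/-- The elements of the direct sum all of whose indices are below `β`. -/
noncomputable def preStage (β : OmegaOne) : Submodule Aᵐᵒᵖ (PreM A H L) :=
  (Finsupp.supported Aᵐᵒᵖ Aᵐᵒᵖ {p | p.1.1 < β}).prod (Finsupp.supported H Aᵐᵒᵖ {δ | δ.1 < β})

/-- The submodule `M_β` of `M`, for `β < ω₁`. -/
noncomputable def stage (β : OmegaOne) : Submodule Aᵐᵒᵖ (GroupM T L) :=
  (preStage A H L β).map (relations T L).mkQ

/-! ### The stages satisfy the recursion

Together with `x_{α,i} ∈ M_{α+1}`, the next facts are the recursion clauses: `M_0 = 0`, unions at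
limits, `M_{α+1} = M_α ⊕ ⨁ i, x_{α,i} A` for `α ∉ E`, and for `δ ∈ E` the pushout
`M_{δ+1} = M_δ + θ_δ(H)` with `θ_δ(b_{n,i}) = x_{η_δ(n),i}` and `θ_δ⁻¹(M_δ) = B`. -/

/-- The elements `b_{n,i}` form a linearly independent family. -/
theorem Template.linearIndependent_b :
    LinearIndependent Aᵐᵒᵖ fun q : ℕ × ℕ => T.b q.1 q.2 := by
  classical
  rw [linearIndependent_iff]
  intro c hc
  by_contra hne
  have hs : (c.support.image Prod.fst).Nonempty :=
    (Finsupp.support_nonempty_iff.2 hne).image _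
  set n := (c.support.image Prod.fst).max' hs with hn
  obtain ⟨q, hq, hqn⟩ := Finset.mem_image.1 ((c.support.image Prod.fst).max'_mem hs)
  have hle : ∀ p ∈ c.support, p.1 ≤ n := fun p hp =>
    Finset.le_max' _ _ (Finset.mem_image_of_mem _ hp)
  have hinj : Function.Injective (fun i : ℕ => (n, i)) := fun i j h => (Prod.mk.inj h).2
  have hz : Finsupp.linearCombination Aᵐᵒᵖ (fun i => (T.Bn n).mkQ (T.b n i))
      (c.comapDomain (fun i => (n, i)) hinj.injOn) = 0 := by
    have h0 : (T.Bn n).mkQ (Finsupp.linearCombination Aᵐᵒᵖ (fun q : ℕ × ℕ => T.b q.1 q.2) c) = 0 := by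
      rw [hc, map_zero]
    rw [Finsupp.linearCombination_apply, Finsupp.sum, map_sum] at h0
    rw [Finsupp.linearCombination_apply, Finsupp.sum, ← h0, Finsupp.comapDomain_support]
    refine Finset.sum_of_injOn (fun i => (n, i)) hinj.injOn ?_ ?_ ?_
    · intro i hi
      simpa using hi
    · intro p hp hp'
      have hlt : p.1 < n := by
        refine lt_of_le_of_ne (hle p hp) fun h => hp' ?_
        refine ⟨p.2, ?_, ?_⟩
        · simpa [← h] using hp
        · simp [← h]
      rw [map_smul]
      have : (T.Bn n).mkQ (T.b p.1 p.2) = 0 := by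
        rw [Submodule.mkQ_apply, Submodule.Quotient.mk_eq_zero]
        exact T.Bn_mono hlt (T.b_mem _ _)
      rw [this, smul_zero]
    · intro i _
      simp
  have h1 := linearIndependent_iff.1 (T.b_linearIndependent n) _ hz
  have h2 := DFunLike.congr_fun h1 q.2
  rw [Finsupp.comapDomain_apply] at h2
  have h3 : ((n, q.2) : ℕ × ℕ) = q := Prod.ext hqn.symm rfl
  rw [h3] at h2
  exact (Finsupp.mem_support_iff.1 hq) h2

theorem Template.span_b_le (n : ℕ) :
    T.Bn n ≤ Submodule.span Aᵐᵒᵖ (Set.range fun q : ℕ × ℕ => T.b q.1 q.2) := by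
  induction n with
  | zero => rw [T.Bn_zero]; exact bot_le
  | succ n ih =>
    intro h hh
    have h1 : (T.Bn n).mkQ h ∈ Submodule.span Aᵐᵒᵖ (Set.range fun i => (T.Bn n).mkQ (T.b n i)) := by
      rw [T.b_span]; exact Submodule.mem_map_of_mem hh
    have h2 : (Set.range fun i => (T.Bn n).mkQ (T.b n i))
        = (T.Bn n).mkQ '' (Set.range fun i => T.b n i) := by
      rw [← Set.range_comp]; rfl
    rw [h2, Submodule.span_image] at h1
    obtain ⟨g, hg, hgh⟩ := h1
    have h3 : h - g ∈ T.Bn n := by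
      rw [← Submodule.Quotient.mk_eq_zero, Submodule.Quotient.mk_sub, sub_eq_zero]
      exact hgh.symm
    have h4 : g ∈ Submodule.span Aᵐᵒᵖ (Set.range fun q : ℕ × ℕ => T.b q.1 q.2) := by
      refine Submodule.span_mono ?_ hg
      rintro _ ⟨i, rfl⟩
      exact ⟨(n, i), rfl⟩
    simpa using add_mem (ih h3) h4

/-- The elements `b_{n,i}` generate `B`. -/
theorem Template.span_b :
    Submodule.span Aᵐᵒᵖ (Set.range fun q : ℕ × ℕ => T.b q.1 q.2) = T.B := by
  apply le_antisymm
  · rw [Submodule.span_le]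
    rintro _ ⟨q, rfl⟩
    exact (le_iSup T.Bn (q.1 + 1)) (T.b_mem _ _)
  · exact iSup_le T.span_b_le

/-- The `δ`-th coordinate in `H` of a linear combination of relators. -/
theorem snd_linearCombination_relator (c : L.E × ℕ × ℕ →₀ Aᵐᵒᵖ) (δ : L.E) :
    (Finsupp.linearCombination Aᵐᵒᵖ (relator T L) c).2 δ =
      Finsupp.linearCombination Aᵐᵒᵖ (fun q : ℕ × ℕ => T.b q.1 q.2)
        (c.comapDomain (Prod.mk δ) (Prod.mk_right_injective δ).injOn) := by
  classical
  induction c using Finsupp.induction_linear with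
  | zero =>
    rw [map_zero]
    have : (0 : L.E × ℕ × ℕ →₀ Aᵐᵒᵖ).comapDomain (Prod.mk δ)
        (Prod.mk_right_injective δ).injOn = 0 := by
      ext p
      rfl
    rw [this, map_zero]
    rfl
  | add f g hf hg =>
    rw [map_add, Prod.snd_add, Finsupp.add_apply, hf, hg, ← map_add]
    congr 1
    ext p
    rfl
  | single t a =>
    obtain ⟨ε, q⟩ := t
    by_cases h : ε = δ
    · subst h
      have : (Finsupp.single (ε, q) a).comapDomain (Prod.mk ε)
          (Prod.mk_right_injective ε).injOn = Finsupp.single q a := by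
        ext p
        rw [Finsupp.comapDomain_apply]
        simp [Finsupp.single_apply]
      rw [this]
      simp [relator]
    · have : (Finsupp.single (ε, q) a).comapDomain (Prod.mk δ)
          (Prod.mk_right_injective δ).injOn = 0 := by
        ext p
        rw [Finsupp.comapDomain_apply]
        simp [h]
      rw [this]
      simp [relator, h]

/-- A linear combination of relators whose `δ`-th coordinate vanishes does not involve the relators
belonging to `δ`. -/
theorem coeff_eq_zero (c : L.E × ℕ × ℕ →₀ Aᵐᵒᵖ) (δ : L.E)
    (h : (Finsupp.linearCombination Aᵐᵒᵖ (relator T L) c).2 δ = 0) (q : ℕ × ℕ) :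
    c (δ, q) = 0 := by
  rw [snd_linearCombination_relator] at h
  exact DFunLike.congr_fun (linearIndependent_iff.1 T.linearIndependent_b _ h) q

theorem mem_preStage {β : OmegaOne} {p : PreM A H L} :
    p ∈ preStage A H L β ↔ (∀ q, β ≤ q.1.1 → p.1 q = 0) ∧ (∀ δ, β ≤ δ.1 → p.2 δ = 0) := by
  simp only [preStage, Submodule.mem_prod, Finsupp.mem_supported', Set.mem_ofPred_eq, not_lt]

/-- If all coordinates in copies of `H` with index `≥ β` of an element of the relation submodule
vanish, the element involves only indices below `β`. -/
theorem relation_mem_preStage {β : OmegaOne} {p : PreM A H L} (hp : p ∈ relations T L)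
    (h : ∀ δ : L.E, β ≤ δ.1 → p.2 δ = 0) : p ∈ preStage A H L β := by
  classical
  rw [relations, ← Finsupp.range_linearCombination] at hp
  obtain ⟨c, rfl⟩ := hp
  rw [Finsupp.linearCombination_apply]
  refine Submodule.sum_mem _ fun t ht => Submodule.smul_mem _ _ ?_
  have hlt : t.1.1 < β := by
    by_contra hle
    exact (Finsupp.mem_support_iff.1 ht) (coeff_eq_zero T L c t.1 (h t.1 (not_lt.1 hle)) t.2)
  rw [mem_preStage]
  constructor
  · intro q hq
    have : q ≠ (⟨L.η t.1 t.2.1, L.η_notMem t.1 t.2.1⟩, t.2.2) := by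
      rintro rfl
      exact absurd ((L.η_lt t.1 t.2.1).trans hlt) (not_lt.2 hq)
    simp [relator, this.symm]
  · intro δ hδ
    have : t.1 ≠ δ := by
      rintro rfl
      exact absurd hlt (not_lt.2 hδ)
    simp [relator, this]

theorem mkQ_mem_stage {β : OmegaOne} {p : PreM A H L} :
    (relations T L).mkQ p ∈ stage T L β ↔ ∃ p' ∈ preStage A H L β, p - p' ∈ relations T L := by
  rw [stage, Submodule.mem_map]
  refine exists_congr fun p' => and_congr_right fun _ => ?_
  rw [eq_comm, ← sub_eq_zero, ← map_sub, Submodule.mkQ_apply, Submodule.Quotient.mk_eq_zero]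

theorem stage_mono : Monotone (stage T L) := by
  intro α β h
  refine Submodule.map_mono fun p hp => ?_
  rw [mem_preStage] at hp ⊢
  exact ⟨fun q hq => hp.1 q (h.trans hq), fun δ hδ => hp.2 δ (h.trans hδ)⟩

theorem x_mem_stage (α : {α : OmegaOne // α ∉ L.E}) (i : ℕ) {β : OmegaOne} (h : α.1 < β) :
    xElt T L α i ∈ stage T L β := by
  classical
  refine Submodule.mem_map_of_mem ?_
  rw [mem_preStage]
  refine ⟨fun q hq => ?_, fun _ _ => rfl⟩
  have : (α, i) ≠ q := by
    rintro rfl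
    exact absurd h (not_lt.2 hq)
  simp [this]

theorem theta_mem_stage (δ : L.E) (h : H) {β : OmegaOne} (hδ : δ.1 < β) :
    theta T L δ h ∈ stage T L β := by
  classical
  refine Submodule.mem_map_of_mem ?_
  rw [mem_preStage]
  refine ⟨fun _ _ => rfl, fun ε hε => ?_⟩
  have : δ ≠ ε := by
    rintro rfl
    exact absurd hδ (not_lt.2 hε)
  simp [this]

/-- The stages are generated by the `x_{α,i}` and `θ_δ(H)` of smaller index. -/
theorem stage_eq (β : OmegaOne) : stage T L β =
    (⨆ α : {α : OmegaOne // α ∉ L.E}, ⨆ _ : α.1 < β,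
      Submodule.span Aᵐᵒᵖ (Set.range (xElt T L α))) ⊔
    (⨆ δ : L.E, ⨆ _ : δ.1 < β, LinearMap.range (theta T L δ)) := by
  classical
  apply le_antisymm
  · rw [stage, Submodule.map_le_iff_le_comap]
    rintro ⟨f, g⟩ hp
    have hp' := hp
    rw [preStage, Submodule.mem_prod] at hp'
    rw [Submodule.mem_comap]
    have hfg : ((f, g) : PreM A H L) = (f, 0) + (0, g) := by simp
    rw [hfg, map_add]
    refine Submodule.add_mem_sup ?_ ?_
    · have hf : ((f, 0) : PreM A H L) = ∑ q ∈ f.support,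
          f q • ((Finsupp.single q 1, 0) : PreM A H L) := by
        ext1
        · rw [Prod.fst_sum]
          conv_lhs => rw [← Finsupp.sum_single f]
          simp [Finsupp.sum]
        · rw [Prod.snd_sum]; simp
      rw [hf, map_sum]
      refine Submodule.sum_mem _ fun q hq => ?_
      rw [map_smul]
      refine Submodule.smul_mem _ _ ?_
      refine Submodule.mem_iSup_of_mem q.1 (Submodule.mem_iSup_of_mem (hp'.1 hq) ?_)
      exact Submodule.subset_span ⟨q.2, rfl⟩
    · have hg : ((0, g) : PreM A H L) = ∑ δ ∈ g.support,
          ((0, Finsupp.single δ (g δ)) : PreM A H L) := by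
        ext1
        · rw [Prod.fst_sum]; simp
        · rw [Prod.snd_sum]
          conv_lhs => rw [← Finsupp.sum_single g]
          rfl
      rw [hg, map_sum]
      refine Submodule.sum_mem _ fun δ hδ => ?_
      exact Submodule.mem_iSup_of_mem δ (Submodule.mem_iSup_of_mem (hp'.2 hδ) ⟨g δ, rfl⟩)
  · refine sup_le (iSup₂_le fun α hα => ?_) (iSup₂_le fun δ hδ => ?_)
    · rw [Submodule.span_le]
      rintro _ ⟨i, rfl⟩
      exact x_mem_stage T L α i hα
    · rintro _ ⟨h, rfl⟩
      exact theta_mem_stage T L δ h hδ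

/-- `M_0 = 0`. -/
theorem stage_of_isMin {β : OmegaOne} (hβ : IsMin β) : stage T L β = ⊥ := by
  rw [stage_eq, eq_bot_iff]
  exact sup_le (iSup₂_le fun α hα => (hβ.not_lt hα).elim) (iSup₂_le fun α hα => (hβ.not_lt hα).elim)

/-- `M_β = ⋃_{α < β} M_α` for limit ordinals `β`. -/
theorem stage_of_isSuccLimit {β : OmegaOne} (hβ : Order.IsSuccLimit β) :
    stage T L β = ⨆ α : Set.Iio β, stage T L α := by
  apply le_antisymm
  · rw [stage_eq]
    refine sup_le (iSup₂_le fun α hα => ?_) (iSup₂_le fun δ hδ => ?_)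
    · obtain ⟨γ, hγ, hαγ⟩ := hβ.lt_iff_exists_lt.1 hα
      refine le_trans ?_ (le_iSup (fun α : Set.Iio β => stage T L α) ⟨γ, hγ⟩)
      rw [Submodule.span_le]
      rintro _ ⟨i, rfl⟩
      exact x_mem_stage T L α i hαγ
    · obtain ⟨γ, hγ, hδγ⟩ := hβ.lt_iff_exists_lt.1 hδ
      refine le_trans ?_ (le_iSup (fun α : Set.Iio β => stage T L α) ⟨γ, hγ⟩)
      rintro _ ⟨h, rfl⟩
      exact theta_mem_stage T L δ h hδγ
  · exact iSup_le fun α => stage_mono T L (le_of_lt α.2)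

/-- `M_{α+1}` is generated by `M_α` and the `x_{α,i}`, if `α ∉ E`. -/
theorem stage_succ_of_notMem (α : {α : OmegaOne // α ∉ L.E}) {β : OmegaOne}
    (h : ∀ γ, γ < β ↔ γ ≤ α.1) :
    stage T L β = stage T L α ⊔ Submodule.span Aᵐᵒᵖ (Set.range (xElt T L α)) := by
  have hαβ : α.1 < β := (h _).2 le_rfl
  apply le_antisymm
  · rw [stage_eq]
    refine sup_le (iSup₂_le fun γ hγ => ?_) (iSup₂_le fun δ hδ => ?_)
    · rcases ((h _).1 hγ).lt_or_eq with hlt | heq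
      · refine le_trans ?_ le_sup_left
        rw [Submodule.span_le]
        rintro _ ⟨i, rfl⟩
        exact x_mem_stage T L γ i hlt
      · rw [Subtype.ext heq]
        exact le_sup_right
    · rcases ((h _).1 hδ).lt_or_eq with hlt | heq
      · refine le_trans ?_ le_sup_left
        rintro _ ⟨g, rfl⟩
        exact theta_mem_stage T L δ g hlt
      · exact absurd (heq ▸ δ.2) α.2
  · refine sup_le (stage_mono T L hαβ.le) ?_
    rw [Submodule.span_le]
    rintro _ ⟨i, rfl⟩
    exact x_mem_stage T L α i hαβ

theorem linearCombination_x (α : {α : OmegaOne // α ∉ L.E}) (c : ℕ →₀ Aᵐᵒᵖ) :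
    Finsupp.linearCombination Aᵐᵒᵖ (xElt T L α) c =
      (relations T L).mkQ (c.mapDomain (fun i => (α, i)), 0) := by
  have : Finsupp.linearCombination Aᵐᵒᵖ (xElt T L α) =
      (relations T L).mkQ ∘ₗ LinearMap.inl _ _ _ ∘ₗ
        Finsupp.lmapDomain Aᵐᵒᵖ Aᵐᵒᵖ (fun i => (α, i)) := by
    ext i
    simp [xElt]
  rw [this]
  rfl

/-- The `x_{α,i}` are linearly independent modulo `M_α`, if `α ∉ E`. -/
theorem x_linearIndependent_mod (α : {α : OmegaOne // α ∉ L.E}) :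
    LinearIndependent Aᵐᵒᵖ fun i => (stage T L α).mkQ (xElt T L α i) := by
  classical
  rw [linearIndependent_iff]
  intro c hc
  have h1 : Finsupp.linearCombination Aᵐᵒᵖ (xElt T L α) c ∈ stage T L α := by
    rw [← Submodule.Quotient.mk_eq_zero, ← Submodule.mkQ_apply, ← hc]
    exact Finsupp.apply_linearCombination _ _ _ _
  rw [linearCombination_x, mkQ_mem_stage] at h1
  obtain ⟨p, hp, hr⟩ := h1
  have hp' := (mem_preStage L).1 hp
  have h2 := (mem_preStage L).1 (relation_mem_preStage T L (β := α.1) hr fun δ hδ => by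
    simp [hp'.2 δ hδ])
  ext i
  have h3 := h2.1 (α, i) le_rfl
  have h4 := hp'.1 (α, i) le_rfl
  have h5 : (c.mapDomain (fun i => (α, i))) (α, i) = 0 := by
    simpa [h4] using h3
  have hinj : Function.Injective (fun i : ℕ => (α, i)) := fun i j h => (Prod.mk.inj h).2
  rw [Finsupp.mapDomain_apply hinj] at h5
  simpa using h5

/-- `θ_δ` sends `b_{n,i}` to `x_{η_δ(n),i}`. -/
theorem theta_b (δ : L.E) (n i : ℕ) :
    theta T L δ (T.b n i) = xElt T L ⟨L.η δ n, L.η_notMem δ n⟩ i := by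
  rw [← sub_eq_zero]
  have : theta T L δ (T.b n i) - xElt T L ⟨L.η δ n, L.η_notMem δ n⟩ i =
      (relations T L).mkQ (relator T L (δ, n, i)) := by
    simp only [theta, xElt, relator, LinearMap.comp_apply, ← map_sub]
    congr 1
    simp
  rw [this, Submodule.mkQ_apply, Submodule.Quotient.mk_eq_zero]
  exact Submodule.subset_span ⟨_, rfl⟩

/-- `M_{δ+1} = M_δ + θ_δ(H)`, if `δ ∈ E`. -/
theorem stage_succ_of_mem (δ : L.E) {β : OmegaOne} (h : ∀ γ, γ < β ↔ γ ≤ δ.1) :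
    stage T L β = stage T L δ ⊔ LinearMap.range (theta T L δ) := by
  have hδβ : δ.1 < β := (h _).2 le_rfl
  apply le_antisymm
  · rw [stage_eq]
    refine sup_le (iSup₂_le fun γ hγ => ?_) (iSup₂_le fun ε hε => ?_)
    · rcases ((h _).1 hγ).lt_or_eq with hlt | heq
      · refine le_trans ?_ le_sup_left
        rw [Submodule.span_le]
        rintro _ ⟨i, rfl⟩
        exact x_mem_stage T L γ i hlt
      · exact absurd (heq ▸ δ.2) γ.2
    · rcases ((h _).1 hε).lt_or_eq with hlt | heq
      · refine le_trans ?_ le_sup_left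
        rintro _ ⟨g, rfl⟩
        exact theta_mem_stage T L ε g hlt
      · rw [Subtype.ext heq]
        exact le_sup_right
  · refine sup_le (stage_mono T L hδβ.le) ?_
    rintro _ ⟨g, rfl⟩
    exact theta_mem_stage T L δ g hδβ

/-- `θ_δ⁻¹(M_δ) = B`, if `δ ∈ E`; so `θ_δ` induces an isomorphism of `H / B` onto
`M_{δ+1} / M_δ`. -/
theorem comap_theta_stage (δ : L.E) : (stage T L δ).comap (theta T L δ) = T.B := by
  classical
  apply le_antisymm
  · intro g hg
    obtain ⟨p, hp, hr⟩ := (mkQ_mem_stage T L).1 (Submodule.mem_comap.1 hg)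
    have hp' := (mem_preStage L).1 hp
    rw [relations, ← Finsupp.range_linearCombination] at hr
    obtain ⟨c, hc⟩ := hr
    have h1 := snd_linearCombination_relator T L c δ
    rw [hc] at h1
    have h2 : g = Finsupp.linearCombination Aᵐᵒᵖ (fun q : ℕ × ℕ => T.b q.1 q.2)
        (c.comapDomain (Prod.mk δ) (Prod.mk_right_injective δ).injOn) := by
      rw [← h1]
      simp [hp'.2 δ le_rfl]
    rw [h2, ← T.span_b, ← Finsupp.range_linearCombination]
    exact ⟨_, rfl⟩
  · rw [← T.span_b, Submodule.span_le]
    rintro _ ⟨q, rfl⟩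
    rw [SetLike.mem_coe, Submodule.mem_comap, theta_b]
    exact x_mem_stage T L _ _ (L.η_lt _ _)

/-- `M = ⋃_{β < ω₁} M_β`. -/
theorem exists_mem_stage (m : GroupM T L) : ∃ β, m ∈ stage T L β := by
  classical
  obtain ⟨⟨f, g⟩, rfl⟩ := (relations T L).mkQ_surjective m
  have : NoMaxOrder OmegaOne :=
    Ordinal.isSuccPrelimit_type_lt_iff.1 (by
      rw [Ordinal.type_toType]
      exact (Cardinal.isSuccLimit_omega 1).isSuccPrelimit)
  have : Nonempty OmegaOne := Ordinal.nonempty_toType_iff.2 (Ordinal.omega_pos 1).ne'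
  obtain ⟨μ, hμ⟩ := ((f.support.image fun q => q.1.1) ∪ (g.support.image Subtype.val)).exists_le
  obtain ⟨β, hβ⟩ := exists_gt μ
  refine ⟨β, Submodule.mem_map_of_mem ?_⟩
  rw [mem_preStage]
  constructor
  · intro q hq
    by_contra hne
    exact absurd (hq.trans (hμ _ (Finset.mem_union_left _
      (Finset.mem_image_of_mem _ (Finsupp.mem_support_iff.2 hne))))) (not_le.2 hβ)
  · intro δ hδ
    by_contra hne
    exact absurd (hδ.trans (hμ _ (Finset.mem_union_right _
      (Finset.mem_image_of_mem _ (Finsupp.mem_support_iff.2 hne))))) (not_le.2 hβ)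

end Construction

end KaplanskyTest

/-!
Let `s_1, …, s_n` be endomorphisms of the abelian group `M` satisfying some equations over `A`. The
stages `M_β` are countable, so the `δ < ω₁` for which all `s_i` map `M_δ` to itself contain a club,
and the stationary set `E` contains such a `δ` (`exists_stage_invariant`). Now
`M_{δ+1} / M_δ ≅ H / B ≅ G`. If each `s_i` maps `M_{δ+1}` to itself, it induces an endomorphism of
`G`, hence acts on `M_{δ+1} / M_δ` as some `t_i ∈ A`. As `A` acts faithfully on `G`, the `t_i`
satisfy the same equations (`isAlgClosedIn_of_subring`, applied to the subring `actsAs`).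

That `M_{δ+1}` is mapped to itself means that the homomorphism `G → M / M_{δ+1}` induced by `s_i`
vanishes. Its image is countable, hence contained in `M_β / M_{δ+1}` for some `β < ω₁`. Two facts
finish the argument.

* `M_β / M_α` embeds in a free `A`-module whenever `α ∉ E` and `β < ω₁`
  (`exists_linearMap_ker_eq_stage`). This is where the tree-like ladders enter: the countably many
  ladders between `α` and `β` have pairwise disjoint tails, and all the `H / B_n` are free.
* There are no nonzero homomorphisms from `G` to free `A`-modules. Since `A` acts faithfully on the
  functions of infinite words, homomorphisms `A → ℤ` separate the points of `A`
  (`exists_functional_ne_zero`), and it suffices that `Hom(G, ℤ) = 0` (`addMonoidHom_int_eq_zero`).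
  A nonzero `φ : G → ℤ` yields endomorphisms `y ↦ φ(y) g` of rank one, which must come from `A`; but
  every nonzero two-sided ideal of `A` contains a nonzero integer (`exists_mul_mul_eq_intCast`),
  while the elements of `A` acting with finite rank form an ideal containing none, as `G` has infinite
  rank, being isomorphic to `G^{r+1}`.
-/

namespace KaplanskyTest

/-! ### The ring `A_r`: words and two-sided ideals -/

section Ring

variable {r : ℕ}

/-- The quotient map from the free ring onto `A_r`. -/
noncomputable def CornerRing.mk (r : ℕ) : FreeAlgebra ℤ (Gen r) →+* CornerRing r :=
  RingQuot.mkRingHom (CornerRel r)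

theorem CornerRing.mk_surjective (r : ℕ) : Function.Surjective (CornerRing.mk r) :=
  RingQuot.mkRingHom_surjective (CornerRel r)

/-- The generator `ρ_i` of `A_r`. -/
noncomputable def rho (i : Fin (r + 1)) : CornerRing r :=
  CornerRing.mk r (FreeAlgebra.ι ℤ (Gen.rho i))

/-- The generator `σ_i` of `A_r`. -/
noncomputable def sigma (i : Fin (r + 1)) : CornerRing r :=
  CornerRing.mk r (FreeAlgebra.ι ℤ (Gen.sigma i))

theorem rho_mul_sigma_same (i : Fin (r + 1)) : rho i * sigma i = 1 := by
  rw [rho, sigma, ← map_mul, ← map_one (CornerRing.mk r)]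
  exact RingQuot.mkRingHom_rel (CornerRel.rho_sigma_same i)

theorem rho_mul_sigma_ne {i j : Fin (r + 1)} (h : i ≠ j) : rho j * sigma i = 0 := by
  rw [rho, sigma, ← map_mul, ← map_zero (CornerRing.mk r)]
  exact RingQuot.mkRingHom_rel (CornerRel.rho_sigma_ne i j h)

theorem sum_sigma_mul_rho : ∑ i : Fin (r + 1), sigma i * rho i = 1 := by
  simp only [rho, sigma, ← map_mul]
  rw [← map_sum, ← map_one (CornerRing.mk r)]
  exact RingQuot.mkRingHom_rel CornerRel.sum_sigma_rho

theorem CornerRing.induction {p : CornerRing r → Prop} (hint : ∀ n : ℤ, p n)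
    (hrho : ∀ i, p (rho i)) (hsigma : ∀ i, p (sigma i))
    (hadd : ∀ a b, p a → p b → p (a + b)) (hmul : ∀ a b, p a → p b → p (a * b))
    (c : CornerRing r) : p c := by
  obtain ⟨x, rfl⟩ := CornerRing.mk_surjective r c
  induction x with
  | grade0 n =>
    have h := hint n
    rwa [← map_intCast (CornerRing.mk r)] at h
  | grade1 g =>
    cases g with
    | rho i => exact hrho i
    | sigma i => exact hsigma i
  | mul a b ha hb => rw [map_mul]; exact hmul _ _ ha hb
  | add a b ha hb => rw [map_add]; exact hadd _ _ ha hb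

instance (r : ℕ) : Countable (Gen r) := by
  have : Function.Injective (fun g : Gen r => match g with
      | .rho i => (Sum.inl i : Fin (r + 1) ⊕ Fin (r + 1))
      | .sigma i => Sum.inr i) := by
    intro g h
    cases g <;> cases h <;> simp
  exact this.countable

instance (r : ℕ) : Countable (CornerRing r) := by
  have : Countable (FreeAlgebra ℤ (Gen r)) := by
    rw [← Cardinal.mk_le_aleph0_iff]
    refine (FreeAlgebra.cardinalMk_le_max_lift ℤ (Gen r)).trans ?_
    simp
  exact (CornerRing.mk_surjective r).countable

/-- The product `σ_{i₁} ⋯ σ_{iₙ}` attached to the word `i₁ ⋯ iₙ`. -/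
noncomputable def sigmaWord (l : List (Fin (r + 1))) : CornerRing r := (l.map sigma).prod

/-- The product `ρ_{iₙ} ⋯ ρ_{i₁}` attached to the word `i₁ ⋯ iₙ`; the order is reversed to make it
a left inverse of `sigmaWord`. -/
noncomputable def rhoWord (l : List (Fin (r + 1))) : CornerRing r := (l.reverse.map rho).prod

theorem sigmaWord_cons (i : Fin (r + 1)) (l : List (Fin (r + 1))) :
    sigmaWord (i :: l) = sigma i * sigmaWord l := by simp [sigmaWord]

theorem sigmaWord_append (l l' : List (Fin (r + 1))) :
    sigmaWord (l ++ l') = sigmaWord l * sigmaWord l' := by simp [sigmaWord]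

theorem rhoWord_cons (i : Fin (r + 1)) (l : List (Fin (r + 1))) :
    rhoWord (i :: l) = rhoWord l * rho i := by simp [rhoWord]

theorem rhoWord_mul_sigmaWord_same (l : List (Fin (r + 1))) : rhoWord l * sigmaWord l = 1 := by
  induction l with
  | nil => simp [rhoWord, sigmaWord]
  | cons i l ih =>
    rw [rhoWord_cons, sigmaWord_cons, mul_assoc, ← mul_assoc (rho i), rho_mul_sigma_same, one_mul,
      ih]

theorem rhoWord_mul_sigmaWord_eq_zero {l l' : List (Fin (r + 1))} (hlen : l.length ≤ l'.length)
    (h : ¬ l <+: l') : rhoWord l * sigmaWord l' = 0 := by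
  induction l generalizing l' with
  | nil => exact absurd (List.nil_prefix) h
  | cons i l ih =>
    cases l' with
    | nil => simp at hlen
    | cons j l' =>
      rw [rhoWord_cons, sigmaWord_cons, mul_assoc, ← mul_assoc (rho i)]
      by_cases hij : j = i
      · subst hij
        rw [rho_mul_sigma_same, one_mul]
        refine ih (by simpa using hlen) fun hp => h ?_
        simpa using hp
      · rw [rho_mul_sigma_ne hij, zero_mul, mul_zero]

/-- The additive group generated by the `σ`-words of length at least `n`. -/
noncomputable def sigmaSpan (r n : ℕ) : Submodule ℤ (CornerRing r) :=
  Submodule.span ℤ (sigmaWord '' {l | n ≤ l.length})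

/-- Multiplying by long enough `σ`-words on the right removes all the `ρ_i` from an element. -/
theorem exists_mul_mem_sigmaSpan (c : CornerRing r) :
    ∀ n, ∃ m, ∀ x ∈ sigmaSpan r m, c * x ∈ sigmaSpan r n := by
  have key : ∀ (c : CornerRing r) (m n : ℕ),
      (∀ l : List (Fin (r + 1)), m ≤ l.length → c * sigmaWord l ∈ sigmaSpan r n) →
      ∀ x ∈ sigmaSpan r m, c * x ∈ sigmaSpan r n := by
    intro c m n h x hx
    induction hx using Submodule.span_induction with
    | mem x hx => obtain ⟨l, hl, rfl⟩ := hx; exact h l hl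
    | zero => simp
    | add x y _ _ hx hy => rw [mul_add]; exact add_mem hx hy
    | smul k x _ hx => rw [mul_smul_comm]; exact Submodule.smul_mem _ _ hx
  induction c using CornerRing.induction with
  | hint k =>
    intro n
    refine ⟨n, fun x hx => ?_⟩
    rw [← zsmul_eq_mul]
    exact Submodule.smul_mem _ _ hx
  | hrho i =>
    intro n
    refine ⟨n + 1, key _ _ _ fun l hl => ?_⟩
    cases l with
    | nil => simp at hl
    | cons j l =>
      rw [sigmaWord_cons, ← mul_assoc]
      by_cases hij : j = i
      · subst hij
        rw [rho_mul_sigma_same, one_mul]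
        exact Submodule.subset_span ⟨l, by simpa using hl, rfl⟩
      · rw [rho_mul_sigma_ne hij, zero_mul]
        exact zero_mem _
  | hsigma i =>
    intro n
    refine ⟨n, key _ _ _ fun l hl => ?_⟩
    rw [← sigmaWord_cons]
    exact Submodule.subset_span ⟨i :: l, by simpa using Nat.le_succ_of_le hl, rfl⟩
  | hadd a b ha hb =>
    intro n
    obtain ⟨m, hm⟩ := ha n
    obtain ⟨m', hm'⟩ := hb n
    have hanti : ∀ {p q : ℕ}, p ≤ q → sigmaSpan r q ≤ sigmaSpan r p := fun h =>
      Submodule.span_mono (Set.image_mono fun l hl => h.trans hl)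
    refine ⟨max m m', fun x hx => ?_⟩
    rw [add_mul]
    exact add_mem (hm x (hanti (le_max_left _ _) hx)) (hm' x (hanti (le_max_right _ _) hx))
  | hmul a b ha hb =>
    intro n
    obtain ⟨m, hm⟩ := ha n
    obtain ⟨m', hm'⟩ := hb m
    refine ⟨m', fun x hx => ?_⟩
    rw [mul_assoc]
    exact hm _ (hm' x hx)

theorem exists_mul_sigmaWord_ne_zero {c : CornerRing r} (hc : c ≠ 0) (n : ℕ) :
    ∃ l : List (Fin (r + 1)), l.length = n ∧ c * sigmaWord l ≠ 0 := by
  induction n generalizing c with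
  | zero => exact ⟨[], rfl, by simpa [sigmaWord] using hc⟩
  | succ n ih =>
    obtain ⟨i, hi⟩ : ∃ i, c * sigma i ≠ 0 := by
      by_contra! h
      apply hc
      rw [← mul_one c, ← sum_sigma_mul_rho, Finset.mul_sum]
      exact Finset.sum_eq_zero fun i _ => by rw [← mul_assoc, h i, zero_mul]
    obtain ⟨l, hl, hne⟩ := ih hi
    exact ⟨i :: l, by simp [hl], by rwa [sigmaWord_cons, ← mul_assoc]⟩

/-- The word `0ᵏ1` does not overlap with a nontrivial shift of itself by at most `k` letters. -/
theorem eq_nil_of_prefix {α : Type*} {a b : α} (hab : a ≠ b) {k : ℕ} {l : List α}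
    (hl : l.length ≤ k) (h : List.replicate k a ++ [b] <+: l ++ (List.replicate k a ++ [b])) :
    l = [] := by
  by_contra hne
  have hpos : 0 < l.length := List.length_pos_iff.2 hne
  have h1 : (List.replicate k a ++ [b])[k]? = some b := by simp
  have h2 : (l ++ (List.replicate k a ++ [b]))[k]? = some a := by
    rw [List.getElem?_append_right hl, List.getElem?_append_left (by simp; omega),
      List.getElem?_replicate_of_lt (by omega)]
  obtain ⟨t, ht⟩ := h
  rw [← ht, List.getElem?_append_left (by simp), h1] at h2
  exact hab (Option.some.inj h2).symm

/-- Every nonzero two-sided ideal of `A_r` contains a nonzero integer. The hypothesis `0 < r`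
provides two different letters. -/
theorem exists_mul_mul_eq_intCast (hr : 0 < r) {c : CornerRing r} (hc : c ≠ 0) :
    ∃ (a b : CornerRing r) (m : ℤ), m ≠ 0 ∧ a * c * b = m := by
  classical
  obtain ⟨n, hn⟩ := exists_mul_mem_sigmaSpan c 0
  obtain ⟨v, hv, hcv⟩ := exists_mul_sigmaWord_ne_zero hc n
  have hmem := hn _ (Submodule.subset_span ⟨v, hv.ge, rfl⟩)
  have hset : {l : List (Fin (r + 1)) | 0 ≤ l.length} = Set.univ := by simp
  rw [sigmaSpan, hset, Set.image_univ, ← Finsupp.range_linearCombination] at hmem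
  obtain ⟨f, hf⟩ := hmem
  have hf0 : f ≠ 0 := by
    rintro rfl
    exact hcv (by rw [← hf, map_zero])
  -- A shortest word `u` occurring in `c σ_v` becomes the constant term after cancelling it.
  obtain ⟨u, hu, hmin⟩ := f.support.exists_min_image List.length (Finsupp.support_nonempty_iff.2 hf0)
  set k := f.support.sup List.length
  have hab : (0 : Fin (r + 1)) ≠ Fin.last r := by
    simp [Fin.ext_iff]; omega
  -- Multiplying by `ρ_w` and `σ_w` kills all other terms, as `w` overlaps with no shift of itself.
  set w : List (Fin (r + 1)) := List.replicate k 0 ++ [Fin.last r]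
  refine ⟨rhoWord (u ++ w), sigmaWord (v ++ w), f u, Finsupp.mem_support_iff.1 hu, ?_⟩
  rw [sigmaWord_append, mul_assoc, ← mul_assoc c, ← hf, Finsupp.linearCombination_apply,
    Finsupp.sum, Finset.sum_mul, Finset.mul_sum, Finset.sum_eq_single u]
  · rw [smul_mul_assoc, mul_smul_comm, ← sigmaWord_append, rhoWord_mul_sigmaWord_same]
    simp
  · intro l hl hlu
    rw [smul_mul_assoc, mul_smul_comm, ← sigmaWord_append, rhoWord_mul_sigmaWord_eq_zero, smul_zero]
    · simpa using hmin l hl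
    · intro hp
      have hul : u <+: l := List.prefix_of_prefix_length_le
        ((List.prefix_append u w).trans hp) (List.prefix_append l w) (hmin l hl)
      obtain ⟨t, rfl⟩ := hul
      rw [List.append_assoc, List.prefix_append_right_inj] at hp
      have ht : t.length ≤ k := by
        have := Finset.le_sup (f := List.length) hl
        simp only [List.length_append] at this
        omega
      exact hlu (by rw [eq_nil_of_prefix hab ht hp, List.append_nil])
  · intro h
    exact absurd hu h

end Ring

/-! ### Homomorphisms from `A_r` to the integers -/

section Functionals

variable {r : ℕ}

/-- The action of the generators of `A_r` on integer-valued functions of infinite words: `ρ_i`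
prepends the letter `i` to the argument, and `σ_i` deletes the first letter of an argument that
begins with `i`. -/
noncomputable def wordRepGen (r : ℕ) : Gen r → Module.End ℤ ((ℕ → Fin (r + 1)) → ℤ)
  | .rho i => LinearMap.funLeft ℤ ℤ fun w n => Nat.casesOn n i w
  | .sigma i =>
    { toFun := fun f w => if w 0 = i then f fun n => w (n + 1) else 0
      map_add' := fun f g => by ext w; by_cases h : w 0 = i <;> simp [h]
      map_smul' := fun k f => by ext w; by_cases h : w 0 = i <;> simp [h] }

/-- The representation of `A_r` on the integer-valued functions of infinite words. -/
noncomputable def wordRep (r : ℕ) : CornerRing r →+* Module.End ℤ ((ℕ → Fin (r + 1)) → ℤ) :=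
  RingQuot.lift ⟨(FreeAlgebra.lift ℤ (wordRepGen r)).toRingHom, by
    intro x y h
    cases h with
    | rho_sigma_same i =>
      simp only [AlgHom.toRingHom_eq_coe, RingHom.coe_coe, map_mul, FreeAlgebra.lift_ι_apply,
        map_one]
      ext f w
      simp [wordRepGen, LinearMap.funLeft]
    | rho_sigma_ne i j h =>
      simp only [AlgHom.toRingHom_eq_coe, RingHom.coe_coe, map_mul, FreeAlgebra.lift_ι_apply,
        map_zero]
      ext f w
      simp [wordRepGen, LinearMap.funLeft, h.symm]
    | sum_sigma_rho =>
      simp only [AlgHom.toRingHom_eq_coe, RingHom.coe_coe, map_sum, map_mul,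
        FreeAlgebra.lift_ι_apply, map_one]
      ext f w
      simp only [wordRepGen, LinearMap.funLeft, LinearMap.sum_apply, Finset.sum_apply,
        Module.End.mul_apply, LinearMap.coe_mk, AddHom.coe_mk, Function.comp_apply,
        Finset.sum_ite_eq, Finset.mem_univ, if_true, Module.End.one_apply]
      exact congrArg f (funext fun n => by cases n <;> rfl)⟩

/-- The additive homomorphisms from `A_r` to `ℤ` separate points. -/
theorem exists_functional_ne_zero (hr : 0 < r) {c : CornerRing r} (hc : c ≠ 0) :
    ∃ φ : CornerRing r →+ ℤ, φ c ≠ 0 := by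
  have hne : wordRep r c ≠ 0 := by
    intro h0
    obtain ⟨a, b, m, hm, habm⟩ := exists_mul_mul_eq_intCast hr hc
    have h1 := congrArg (wordRep r) habm
    rw [map_mul, map_mul, h0, mul_zero, zero_mul, map_intCast] at h1
    have h2 := congrFun (LinearMap.congr_fun h1 fun _ => 1) fun _ => 0
    exact hm (by simpa using h2.symm)
  obtain ⟨f, hf⟩ : ∃ f, wordRep r c f ≠ 0 := by
    by_contra! h
    exact hne (LinearMap.ext h)
  obtain ⟨w, hw⟩ := Function.ne_iff.1 hf
  exact ⟨((Pi.evalAddMonoidHom (fun _ => ℤ) w).comp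
    (LinearMap.toAddMonoidHom (LinearMap.applyₗ f))).comp (wordRep r).toAddMonoidHom, hw⟩

end Functionals

/-! ### Homomorphisms from `G` to free modules -/

section Slender

variable {r : ℕ} {G : Type*} [AddCommGroup G] [Module (CornerRing r)ᵐᵒᵖ G]

theorem exists_actionHom_eq (hG : Function.Bijective (actionHom (CornerRing r) G)) (f : G →+ G) :
    ∃ a : CornerRing r, ∀ g, f g = MulOpposite.op a • g := by
  obtain ⟨a, ha⟩ := hG.2 (MulOpposite.op f)
  refine ⟨a, fun g => ?_⟩
  rw [← actionHom_apply, ha]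
  rfl

/-- If `φ : G → ℤ` were not zero, then for a suitable `g` the endomorphism `y ↦ φ(y) g` of rank one
would be right multiplication by a nonzero `c`. As a two-sided multiple of `c` is a nonzero integer,
`G` would have rank at most one, which is absurd since `G = G σ_0 ⊕ ⋯ ⊕ G σ_r` with
`G ≅ G σ_i`. -/
theorem addMonoidHom_int_eq_zero (hr : 0 < r) [IsAddTorsionFree G]
    (hG : Function.Bijective (actionHom (CornerRing r) G)) (φ : G →+ ℤ) : φ = 0 := by
  by_contra hφ
  obtain ⟨x, hx⟩ : ∃ x, φ x ≠ 0 := by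
    by_contra! h
    exact hφ (AddMonoidHom.ext h)
  have hx0 : x ≠ 0 := by
    rintro rfl
    exact hx (map_zero φ)
  obtain ⟨c, hc⟩ := exists_actionHom_eq hG ((zmultiplesHom G x).comp φ)
  have hc' : ∀ y, MulOpposite.op c • y = φ y • x := fun y => (hc y).symm
  have hc0 : c ≠ 0 := by
    rintro rfl
    have := hc' x
    rw [MulOpposite.op_zero, zero_smul] at this
    exact (smul_ne_zero hx hx0) this.symm
  obtain ⟨a, b, m, hm, habm⟩ := exists_mul_mul_eq_intCast hr hc0
  set z := MulOpposite.op b • x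
  have key : ∀ y, m • y = φ (MulOpposite.op a • y) • z := by
    intro y
    have h1 : MulOpposite.op (a * c * b) • y = m • y := by
      rw [habm, MulOpposite.op_intCast, Int.cast_smul_eq_zsmul]
    rw [← h1, MulOpposite.op_mul, MulOpposite.op_mul, mul_smul, mul_smul, hc', smul_comm]
  have hab : (0 : Fin (r + 1)) ≠ Fin.last r := by
    simp [Fin.ext_iff]; omega
  -- Compare the multiples of `z` that represent `m x ρ_0` and `m x ρ_r`.
  have h0 := key (MulOpposite.op (rho (0 : Fin (r + 1))) • x)
  have h1 := key (MulOpposite.op (rho (Fin.last r)) • x)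
  set k := φ (MulOpposite.op a • MulOpposite.op (rho (0 : Fin (r + 1))) • x)
  set l := φ (MulOpposite.op a • MulOpposite.op (rho (Fin.last r)) • x)
  have h2 := congrArg (fun y : G => MulOpposite.op (sigma (Fin.last r)) • y) h0
  have h3 := congrArg (fun y : G => MulOpposite.op (sigma (Fin.last r)) • y) h1
  have h4 := congrArg (fun y : G => MulOpposite.op (sigma (0 : Fin (r + 1))) • y) h0
  simp only [smul_comm _ m, smul_comm _ k, smul_comm _ l, ← mul_smul, ← MulOpposite.op_mul,
    rho_mul_sigma_same, rho_mul_sigma_ne hab.symm, MulOpposite.op_one, MulOpposite.op_zero,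
    one_smul, zero_smul, smul_zero] at h2 h3 h4
  have hmx : m • x ≠ 0 := smul_ne_zero hm hx0
  rcases smul_eq_zero.1 h2.symm with hk0 | hk0
  · rw [hk0, zero_smul] at h4
    exact hmx h4
  · rw [hk0, smul_zero] at h3
    exact hmx h3

/-- There are no nonzero additive homomorphisms from `G` to free `A`-modules. -/
theorem addMonoidHom_finsupp_eq_zero (hr : 0 < r) [IsAddTorsionFree G]
    (hG : Function.Bijective (actionHom (CornerRing r) G)) {J : Type*}
    (f : G →+ (J →₀ (CornerRing r)ᵐᵒᵖ)) : f = 0 := by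
  ext g j
  by_contra hne
  obtain ⟨φ, hφ⟩ := exists_functional_ne_zero hr
    (c := (f g j).unop) (fun h => hne (MulOpposite.unop_injective h))
  have := addMonoidHom_int_eq_zero hr hG
    (φ.comp (((MulOpposite.opAddEquiv (α := CornerRing r)).symm.toAddMonoidHom).comp
      ((Finsupp.applyAddHom j).comp f)))
  exact hφ (DFunLike.congr_fun this g)

end Slender

/-! ### Countable sets and clubs in `ω₁` -/

section OmegaOne

theorem cof_omegaOne : Order.cof OmegaOne = Cardinal.aleph 1 := by
  rw [Ordinal.cof_toType, Cardinal.cof_omega_one]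

instance : NoMaxOrder OmegaOne :=
  Ordinal.isSuccPrelimit_type_lt_iff.1 (by
    rw [Ordinal.type_toType]
    exact (Cardinal.isSuccLimit_omega 1).isSuccPrelimit)

instance : Nonempty OmegaOne := Ordinal.nonempty_toType_iff.2 (Ordinal.omega_pos 1).ne'

theorem bddAbove_range_of_countable {ι : Type*} [Countable ι] (f : ι → OmegaOne) :
    BddAbove (Set.range f) := by
  refine .of_not_isCofinal fun h => (Order.cof_le h).not_gt ?_
  rw [cof_omegaOne]
  exact (Cardinal.mk_le_aleph0_iff.2 (Set.countable_range f)).trans_lt Cardinal.aleph0_lt_aleph_one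

instance countable_Iio (β : OmegaOne) : Countable (Set.Iio β) := by
  have h := Cardinal.mk_Iio_lt β (by simp [Cardinal.mk_toType])
  rw [Cardinal.mk_toType, Ordinal.card_omega, ← Cardinal.succ_aleph0, Order.lt_succ_iff] at h
  exact Cardinal.mk_le_aleph0_iff.1 h

instance countable_Iic (β : OmegaOne) : Countable (Set.Iic β) := by
  obtain ⟨γ, hγ⟩ := exists_gt β
  exact (Set.inclusion_injective (Set.Iic_subset_Iio.2 hγ)).countable

/-- The closure points of a function `ω₁ → ω₁` form a club. -/
theorem isClub_closurePoints (F : OmegaOne → OmegaOne) :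
    IsClub {δ : OmegaOne | ∀ γ < δ, F γ ≤ δ} := by
  refine ⟨?_, fun a => ?_⟩
  · intro d hd _ _ δ hδ γ hγ
    obtain ⟨ε, hε, hγε⟩ := (lt_isLUB_iff hδ).1 hγ
    exact (hd hε γ hγε).trans (hδ.1 hε)
  · have hstep : ∀ b : OmegaOne, ∃ c, b ≤ c ∧ ∀ γ ≤ b, F γ ≤ c := by
      intro b
      obtain ⟨c, hc⟩ := bddAbove_range_of_countable fun γ : Set.Iic b => F γ
      exact ⟨max b c, le_max_left _ _, fun γ hγ => (hc ⟨⟨γ, hγ⟩, rfl⟩).trans (le_max_right _ _)⟩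
    choose s hs hsF using hstep
    obtain ⟨δ, hδ⟩ : ∃ δ, IsLUB (Set.range fun n => s^[n] a) δ := by
      have hb := bddAbove_range_of_countable fun n => s^[n] a
      exact ⟨wellFounded_lt.min _ hb, wellFounded_lt.min_mem _ hb,
        fun c hc => wellFounded_lt.min_le hc⟩
    refine ⟨δ, fun γ hγ => ?_, hδ.1 ⟨0, rfl⟩⟩
    obtain ⟨_, ⟨n, rfl⟩, hn⟩ := (lt_isLUB_iff hδ).1 hγ
    refine (hsF _ γ hn.le).trans (hδ.1 ⟨n + 1, ?_⟩)
    simp only [Function.iterate_succ_apply']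

end OmegaOne

/-! ### Invariant stages of `M` -/

section Stages

variable {A : Type*} [Ring A] {H : Type*} [AddCommGroup H] [Module Aᵐᵒᵖ H]
  {G : Type*} [AddCommGroup G] [Module Aᵐᵒᵖ G] (T : Template A H G)
  (L : LadderSystem)

include T in
theorem Template.nonempty_basis : Nonempty (Module.Basis ℕ Aᵐᵒᵖ H) := by
  obtain ⟨b⟩ := T.free_quotient 0
  exact ⟨b.map (Submodule.quotEquivOfEqBot _ T.Bn_zero)⟩

include T in
theorem Template.countable [Countable A] : Countable H := by
  obtain ⟨b⟩ := T.nonempty_basis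
  have hA : Countable Aᵐᵒᵖ := MulOpposite.opEquiv.symm.injective.countable
  exact b.repr.toEquiv.injective.countable

/-- The stages `M_β` are countable. -/
theorem countable_stage [Countable A] (β : OmegaOne) : Countable (stage T L β) := by
  have hH := T.countable
  have hA : Countable Aᵐᵒᵖ := MulOpposite.opEquiv.symm.injective.countable
  have hp : Countable {p : {α : OmegaOne // α ∉ L.E} × ℕ | p.1.1 < β} := by
    refine Function.Injective.countable (f := fun p => ((⟨p.1.1.1, p.2⟩, p.1.2) : Set.Iio β × ℕ)) ?_
    rintro ⟨⟨⟨a, ha⟩, i⟩, h⟩ ⟨⟨⟨b, hb⟩, j⟩, h'⟩ hab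
    simpa [Prod.ext_iff, Subtype.ext_iff] using hab
  have hd : Countable {δ : L.E | δ.1 < β} := by
    refine Function.Injective.countable (f := fun p => (⟨p.1.1, p.2⟩ : Set.Iio β)) ?_
    rintro ⟨⟨a, ha⟩, h⟩ ⟨⟨b, hb⟩, h'⟩ hab
    simpa [Prod.ext_iff, Subtype.ext_iff] using hab
  have h1 := (Finsupp.supportedEquivFinsupp (M := Aᵐᵒᵖ) (R := Aᵐᵒᵖ)
    {p : {α : OmegaOne // α ∉ L.E} × ℕ | p.1.1 < β}).injective.countable
  have h2 := (Finsupp.supportedEquivFinsupp (M := H) (R := Aᵐᵒᵖ)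
    {δ : L.E | δ.1 < β}).injective.countable
  have h3 : Set.Countable (preStage A H L β : Set (PreM A H L)) := by
    rw [preStage, Submodule.prod_coe]
    exact Set.Countable.prod (Set.countable_coe_iff.1 h1) (Set.countable_coe_iff.1 h2)
  exact Set.countable_coe_iff.2 (h3.image (relations T L).mkQ)

theorem exists_subset_stage {ι : Type*} [Countable ι] (f : ι → GroupM T L) :
    ∃ β, ∀ i, f i ∈ stage T L β := by
  choose b hb using fun i => exists_mem_stage T L (f i)
  obtain ⟨β, hβ⟩ := bddAbove_range_of_countable b
  exact ⟨β, fun i => stage_mono T L (hβ ⟨i, rfl⟩) (hb i)⟩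

/-- Countably many endomorphisms of `M` map `M_δ` to itself, for some `δ ∈ E`. -/
theorem exists_stage_invariant [Countable A] {ι : Type*} [Countable ι]
    (s : ι → AddMonoid.End (GroupM T L)) :
    ∃ δ : L.E, ∀ i, ∀ m ∈ stage T L δ.1, s i m ∈ stage T L δ.1 := by
  have hF : ∀ γ : OmegaOne, ∃ β, ∀ i, ∀ m ∈ stage T L γ, s i m ∈ stage T L β := by
    intro γ
    have := countable_stage T L γ
    obtain ⟨β, hβ⟩ := exists_subset_stage T L fun p : ι × stage T L γ => s p.1 p.2
    exact ⟨β, fun i m hm => hβ (i, ⟨m, hm⟩)⟩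
  choose F hF using hF
  obtain ⟨δ, hδE, hδ⟩ := L.stationary (isClub_closurePoints F)
  refine ⟨⟨δ, hδE⟩, fun i m hm => ?_⟩
  have hdir : Directed (· ≤ ·) fun α : Set.Iio δ => stage T L α := fun α β =>
    (le_total α.1 β.1).elim (fun h => ⟨β, stage_mono T L h, le_rfl⟩)
      fun h => ⟨α, le_rfl, stage_mono T L h⟩
  have hne : Nonempty (Set.Iio δ) := by
    have := (L.limit δ hδE).not_isMin
    rw [not_isMin_iff] at this
    obtain ⟨γ, hγ⟩ := this
    exact ⟨⟨γ, hγ⟩⟩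
  simp only [stage_of_isSuccLimit T L (L.limit δ hδE)] at hm
  obtain ⟨γ, hγ⟩ := (Submodule.mem_iSup_of_directed _ hdir).1 hm
  exact stage_mono T L (hδ γ γ.2) (hF γ i m hγ)

end Stages

/-! ### Disjoint tails of ladders -/

section Ladders

variable (L : LadderSystem)

theorem LadderSystem.eventually_ne {δ γ : L.E} (h : δ ≠ γ) :
    ∃ N, ∀ n ≥ N, ∀ m, L.η δ n ≠ L.η γ m := by
  by_contra! hcon
  have hag : ∀ l, L.η δ l = L.η γ l := by
    intro l
    obtain ⟨n, hn, m, hnm⟩ := hcon (l + 1)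
    exact (L.treeLike δ γ n m hnm).2 l hn
  rcases lt_trichotomy δ.1 γ.1 with hlt | heq | hlt
  · obtain ⟨n, hn⟩ := L.η_cofinal γ δ.1 hlt
    exact absurd (L.η_lt δ n) (not_lt.2 (hag n ▸ hn))
  · exact h (Subtype.ext heq)
  · obtain ⟨n, hn⟩ := L.η_cofinal δ γ.1 hlt
    exact absurd (L.η_lt γ n) (not_lt.2 (hag n ▸ hn))

/-- For `D` enumerated by `e`, the ladders of members of `D` can be cut off so that what remains of
them lies above `α` and avoids the full ladders of all earlier members of `D`. -/
theorem LadderSystem.exists_tails {D : Set L.E} {α : OmegaOne} (hD : ∀ δ ∈ D, α < δ.1)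
    {e : L.E → ℕ} (he : Set.InjOn e D) :
    ∃ k : L.E → ℕ, (∀ δ ∈ D, ∀ n ≥ k δ, α ≤ L.η δ n) ∧
      ∀ δ ∈ D, ∀ γ ∈ D, e γ < e δ → ∀ n ≥ k δ, ∀ m, L.η δ n ≠ L.η γ m := by
  have hex : ∀ δ : L.E, ∃ K, δ ∈ D → (∀ n ≥ K, α ≤ L.η δ n) ∧
      ∀ γ ∈ D, e γ < e δ → ∀ n ≥ K, ∀ m, L.η δ n ≠ L.η γ m := by
    intro δ
    by_cases hδ : δ ∈ D
    · obtain ⟨n₀, hn₀⟩ := L.η_cofinal δ α (hD δ hδ)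
      have hfin : {γ | γ ∈ D ∧ e γ < e δ}.Finite :=
        Set.Finite.of_finite_image ((Set.finite_Iio (e δ)).subset (by
          rintro _ ⟨γ, hγ, rfl⟩; exact hγ.2)) (he.mono fun γ hγ => hγ.1)
      have hN : ∀ γ : L.E, ∃ N, δ ≠ γ → ∀ n ≥ N, ∀ m, L.η δ n ≠ L.η γ m := by
        intro γ
        by_cases h : δ = γ
        · exact ⟨0, fun h' => absurd h h'⟩
        · obtain ⟨N, hN⟩ := L.eventually_ne h
          exact ⟨N, fun _ => hN⟩
      choose N hN using hN
      refine ⟨max n₀ (hfin.toFinset.sup N), fun _ => ⟨fun n hn => ?_, fun γ hγ hlt n hn => ?_⟩⟩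
      · exact hn₀.trans ((L.η_strictMono δ).monotone ((le_max_left _ _).trans hn))
      · refine hN γ (by rintro rfl; exact lt_irrefl _ hlt) n (le_trans ?_ hn)
        exact (Finset.le_sup (f := N) (hfin.mem_toFinset.2 ⟨hγ, hlt⟩)).trans (le_max_right _ _)
    · exact ⟨0, fun h => absurd h hδ⟩
  choose k hk using hex
  exact ⟨k, fun δ hδ => (hk δ hδ).1, fun δ hδ => (hk δ hδ).2⟩

end Ladders

/-! ### The splitting of `H` over `B_k` -/

section Splitting

variable {A : Type*} [Ring A] {H : Type*} [AddCommGroup H] [Module Aᵐᵒᵖ H]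
  {G : Type*} [AddCommGroup G] [Module Aᵐᵒᵖ G] (T : Template A H G)

theorem Template.Bn_le_span (k : ℕ) :
    T.Bn k ≤ Submodule.span Aᵐᵒᵖ {h | ∃ j < k, ∃ i, h = T.b j i} := by
  induction k with
  | zero => rw [T.Bn_zero]; exact bot_le
  | succ n ih =>
    intro h hh
    have h1 : (T.Bn n).mkQ h ∈ Submodule.span Aᵐᵒᵖ (Set.range fun i => (T.Bn n).mkQ (T.b n i)) := by
      rw [T.b_span]; exact Submodule.mem_map_of_mem hh
    have h2 : (Set.range fun i => (T.Bn n).mkQ (T.b n i))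
        = (T.Bn n).mkQ '' (Set.range fun i => T.b n i) := by
      rw [← Set.range_comp]; rfl
    rw [h2, Submodule.span_image] at h1
    obtain ⟨g, hg, hgh⟩ := h1
    have h3 : h - g ∈ T.Bn n := by
      rw [← Submodule.Quotient.mk_eq_zero, Submodule.Quotient.mk_sub, sub_eq_zero]
      exact hgh.symm
    have h4 : g ∈ Submodule.span Aᵐᵒᵖ {h | ∃ j < n + 1, ∃ i, h = T.b j i} := by
      refine Submodule.span_mono ?_ hg
      rintro _ ⟨i, rfl⟩
      exact ⟨n, Nat.lt_succ_self n, i, rfl⟩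
    have h5 : h - g ∈ Submodule.span Aᵐᵒᵖ {h | ∃ j < n + 1, ∃ i, h = T.b j i} :=
      Submodule.span_mono (by
        rintro x ⟨j, hj, hx⟩
        exact ⟨j, Nat.lt_succ_of_lt hj, hx⟩) (ih h3)
    simpa using add_mem h5 h4

theorem Template.b_mem_of_lt {j k : ℕ} (h : j < k) (i : ℕ) : T.b j i ∈ T.Bn k :=
  T.Bn_mono h (T.b_mem j i)

theorem Template.exists_section (k : ℕ) :
    ∃ s : (H ⧸ T.Bn k) →ₗ[Aᵐᵒᵖ] H, ∀ q, (T.Bn k).mkQ (s q) = q := by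
  obtain ⟨c⟩ := T.free_quotient k
  have := Module.Projective.of_basis c
  obtain ⟨s, hs⟩ := Module.projective_lifting_property (T.Bn k).mkQ LinearMap.id
    (T.Bn k).mkQ_surjective
  exact ⟨s, fun q => LinearMap.congr_fun hs q⟩

variable {X : Type*} [AddCommGroup X] [Module Aᵐᵒᵖ X] {k : ℕ} {s : (H ⧸ T.Bn k) →ₗ[Aᵐᵒᵖ] H}

/-- `H` is the direct sum of `B_k`, which is free on the `b_{j,i}` with `j < k`, and of the image of
a section of `H → H / B_k`, so linear maps may be prescribed on these two parts. -/
theorem Template.exists_linearMap (hs : ∀ q, (T.Bn k).mkQ (s q) = q) (v : ℕ → ℕ → X)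
    (u : (H ⧸ T.Bn k) →ₗ[Aᵐᵒᵖ] X) :
    ∃ h : H →ₗ[Aᵐᵒᵖ] X, (∀ j < k, ∀ i, h (T.b j i) = v j i) ∧ ∀ q, h (s q) = u q := by
  let c := Module.Basis.span T.linearIndependent_b
  let V := c.constr ℕ fun q : ℕ × ℕ => v q.1 q.2
  let π : H →ₗ[Aᵐᵒᵖ] H := LinearMap.id - s ∘ₗ (T.Bn k).mkQ
  have hπ : ∀ x, π x = x - s ((T.Bn k).mkQ x) := fun x => rfl
  have hmem : ∀ x, π x ∈
      Submodule.span Aᵐᵒᵖ (Set.range fun q : ℕ × ℕ => T.b q.1 q.2) := by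
    intro x
    refine T.span_b_le k ?_
    rw [← Submodule.Quotient.mk_eq_zero, ← Submodule.mkQ_apply, hπ, map_sub, hs, sub_self]
  refine ⟨V ∘ₗ LinearMap.codRestrict _ π hmem +
    u ∘ₗ (T.Bn k).mkQ, fun j hj i => ?_, fun q => ?_⟩
  · have h0 : (T.Bn k).mkQ (T.b j i) = 0 := by
      rw [Submodule.mkQ_apply, Submodule.Quotient.mk_eq_zero]
      exact T.b_mem_of_lt hj i
    have h1 : LinearMap.codRestrict _ π hmem (T.b j i) =
        c (j, i) := by
      apply Subtype.ext
      rw [Module.Basis.span_apply, LinearMap.codRestrict_apply, hπ, h0, map_zero, sub_zero]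
    rw [LinearMap.add_apply, LinearMap.comp_apply, LinearMap.comp_apply, h1, h0, map_zero, add_zero,
      Module.Basis.constr_basis]
  · have h1 : LinearMap.codRestrict _ π hmem (s q) = 0 := by
      apply Subtype.ext
      rw [LinearMap.codRestrict_apply, hπ, hs, sub_self]
      rfl
    rw [LinearMap.add_apply, LinearMap.comp_apply, LinearMap.comp_apply, h1, hs, map_zero, zero_add]

theorem Template.linearMap_ext (hs : ∀ q, (T.Bn k).mkQ (s q) = q) {f g : H →ₗ[Aᵐᵒᵖ] X}
    (hb : ∀ j < k, ∀ i, f (T.b j i) = g (T.b j i)) (hq : ∀ q, f (s q) = g (s q)) : f = g := by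
  ext x
  have hmem : x - s ((T.Bn k).mkQ x) ∈ T.Bn k := by
    rw [← Submodule.Quotient.mk_eq_zero, ← Submodule.mkQ_apply, map_sub, hs, sub_self]
  have h1 : f (x - s ((T.Bn k).mkQ x)) = g (x - s ((T.Bn k).mkQ x)) := by
    refine LinearMap.eqOn_span ?_ (T.Bn_le_span k hmem)
    rintro _ ⟨j, hj, i, rfl⟩
    exact hb j hj i
  rw [map_sub, map_sub, hq] at h1
  exact sub_left_injective h1

end Splitting

/-! ### Embedding `M_β / M_α` in a free module -/

section Quotients

variable {A : Type*} [Ring A] {H : Type*} [AddCommGroup H] [Module Aᵐᵒᵖ H]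
  {G : Type*} [AddCommGroup G] [Module Aᵐᵒᵖ G] (T : Template A H G) (L : LadderSystem)

theorem eqOn_preStage {Y : Type*} [AddCommGroup Y] [Module Aᵐᵒᵖ Y] {β : OmegaOne}
    {f g : PreM A H L →ₗ[Aᵐᵒᵖ] Y}
    (h₁ : ∀ q : {α : OmegaOne // α ∉ L.E} × ℕ, q.1.1 < β →
      f (Finsupp.single q 1, 0) = g (Finsupp.single q 1, 0))
    (h₂ : ∀ (δ : L.E), δ.1 < β → ∀ x : H,
      f (0, Finsupp.single δ x) = g (0, Finsupp.single δ x))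
    {p : PreM A H L} (hp : p ∈ preStage A H L β) : f p = g p := by
  classical
  obtain ⟨c, d⟩ := p
  rw [preStage, Submodule.mem_prod] at hp
  have hc : ((c, 0) : PreM A H L) = ∑ q ∈ c.support,
      c q • ((Finsupp.single q 1, 0) : PreM A H L) := by
    ext1
    · rw [Prod.fst_sum]
      conv_lhs => rw [← Finsupp.sum_single c]
      simp [Finsupp.sum]
    · rw [Prod.snd_sum]; simp
  have hd : ((0, d) : PreM A H L) = ∑ δ ∈ d.support,
      ((0, Finsupp.single δ (d δ)) : PreM A H L) := by
    ext1
    · rw [Prod.fst_sum]; simp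
    · rw [Prod.snd_sum]
      conv_lhs => rw [← Finsupp.sum_single d]
      rfl
  have hcd : ((c, d) : PreM A H L) = (c, 0) + (0, d) := by simp
  rw [hcd, map_add, map_add, hc, hd]
  simp only [map_sum, map_smul]
  congr 1
  · exact Finset.sum_congr rfl fun q hq => by rw [h₁ q (hp.1 hq)]
  · exact Finset.sum_congr rfl fun δ hδ => h₂ δ (hp.2 hδ) _

/-- The value assigned to `x_{γ,i}` by a family of maps `h_δ : H → X` to the free module `X` on
two sets of generators, of which the left one consists of copies of the `x_{γ,i}`. It is `0` if
`γ < α`; otherwise it is `h_δ(b_{n,i})` if `γ = η_δ(n)` lies in the tail of the ladder of `δ`, which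
is recorded by `own γ = some (δ, n)`, and the generator belonging to `x_{γ,i}` if `γ` lies in no
tail. -/
noncomputable def xValue (α : OmegaOne) (own : OmegaOne → Option (L.E × ℕ))
    (h : L.E → H →ₗ[Aᵐᵒᵖ] (({α : OmegaOne // α ∉ L.E} × ℕ) ⊕ (L.E × ℕ)) →₀ Aᵐᵒᵖ)
    (q : {α : OmegaOne // α ∉ L.E} × ℕ) :
    (({α : OmegaOne // α ∉ L.E} × ℕ) ⊕ (L.E × ℕ)) →₀ Aᵐᵒᵖ :=
  open Classical in
  if q.1.1 < α then 0 else
    match own q.1.1 with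
    | some (δ, n) => h δ (T.b n q.2)
    | none => Finsupp.single (Sum.inl q) 1

/-- `M_β / M_α` embeds in a free module if `α ∉ E`. The countably many `δ ∈ E` between `α` and `β`
are enumerated and their ladders cut off so that the tails become disjoint; then `M_β / M_α` is free
on the cosets of the `x_{γ,i}` with `γ` in no tail and on lifts of bases of the `H / B_k`, where `k`
is the length of the part cut off. -/
theorem exists_linearMap_ker_eq_stage {α : OmegaOne} (hα : α ∉ L.E) {β : OmegaOne} (hαβ : α ≤ β) :
    ∃ Φ : PreM A H L →ₗ[Aᵐᵒᵖ] (({α : OmegaOne // α ∉ L.E} × ℕ) ⊕ (L.E × ℕ)) →₀ Aᵐᵒᵖ,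
      ∀ p ∈ preStage A H L β, Φ p = 0 ↔ (relations T L).mkQ p ∈ stage T L α := by
  classical
  set D : Set L.E := {δ | α < δ.1 ∧ δ.1 < β}
  have hDc : Countable D := by
    refine Function.Injective.countable (f := fun p => (⟨p.1.1, p.2.2⟩ : Set.Iio β)) ?_
    rintro ⟨⟨a, ha⟩, h⟩ ⟨⟨b, hb⟩, h'⟩ hab
    simpa [Subtype.ext_iff] using hab
  obtain ⟨e, he⟩ := Set.countable_iff_exists_injOn.1 (Set.countable_coe_iff.1 hDc)
  obtain ⟨k, hk₁, hk₂⟩ := L.exists_tails (D := D) (α := α) (fun δ hδ => hδ.1) he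
  -- Different members of `D` have disjoint tails.
  have hdisj : ∀ δ ∈ D, ∀ γ ∈ D, ∀ n ≥ k δ, ∀ m ≥ k γ, L.η δ n = L.η γ m → δ = γ ∧ n = m := by
    intro δ hδ γ hγ n hn m hm h
    refine ⟨he hδ hγ (le_antisymm ?_ ?_), (L.treeLike δ γ n m h).1.symm⟩
    · exact not_lt.1 fun hlt => hk₂ δ hδ γ hγ hlt n hn m h
    · exact not_lt.1 fun hlt => hk₂ γ hγ δ hδ hlt m hm n h.symm
  obtain ⟨own, hown₁, hown₂⟩ : ∃ own : OmegaOne → Option (L.E × ℕ),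
      (∀ δ ∈ D, ∀ n ≥ k δ, own (L.η δ n) = some (δ, n)) ∧
      ∀ γ δ n, own γ = some (δ, n) → δ ∈ D ∧ k δ ≤ n ∧ L.η δ n = γ := by
    have hex : ∀ γ, ∃ o : Option (L.E × ℕ),
        (∀ δ ∈ D, ∀ n ≥ k δ, L.η δ n = γ → o = some (δ, n)) ∧
        ∀ δ n, o = some (δ, n) → δ ∈ D ∧ k δ ≤ n ∧ L.η δ n = γ := by
      intro γ
      by_cases h : ∃ δ ∈ D, ∃ n ≥ k δ, L.η δ n = γ
      · obtain ⟨δ, hδ, n, hn, rfl⟩ := h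
        refine ⟨some (δ, n), fun ε hε m hm hm' => ?_, fun ε m hm => ?_⟩
        · obtain ⟨rfl, rfl⟩ := hdisj ε hε δ hδ m hm n hn hm'
          rfl
        · obtain ⟨rfl, rfl⟩ := Prod.mk.inj (Option.some.inj hm)
          exact ⟨hδ, hn, rfl⟩
      · refine ⟨none, fun δ hδ n hn hγ => absurd ⟨δ, hδ, n, hn, hγ⟩ h, fun δ n hn => ?_⟩
        simp at hn
    choose own h₁ h₂ using hex
    exact ⟨own, fun δ hδ n hn => h₁ _ δ hδ n hn rfl, h₂⟩
  -- A tail that meets the part cut off from the ladder of `δ` belongs to an earlier `γ`; this makes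
  -- the recursion below possible.
  have hearlier : ∀ δ ∈ D, ∀ n < k δ, ∀ γ m, own (L.η δ n) = some (γ, m) → e γ < e δ := by
    intro δ hδ n hn γ m ho
    obtain ⟨hγ, hm, hmn⟩ := hown₂ _ _ _ ho
    refine lt_of_le_of_ne (not_lt.1 fun hlt => hk₂ γ hγ δ hδ hlt m hm n hmn) fun heq => ?_
    obtain rfl := he hγ hδ heq
    have := (L.treeLike _ _ _ _ hmn).1
    omega
  choose s hs using T.exists_section
  let c := fun k => (T.free_quotient k).some
  let u : ∀ δ : L.E, (H ⧸ T.Bn (k δ)) →ₗ[Aᵐᵒᵖ]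
      (({α : OmegaOne // α ∉ L.E} × ℕ) ⊕ (L.E × ℕ)) →₀ Aᵐᵒᵖ :=
    fun δ => (c (k δ)).constr ℕ fun i => Finsupp.single (Sum.inr (δ, i)) 1
  -- The maps `h_δ` are found by recursion along the enumeration `e`.
  obtain ⟨h, hh⟩ : ∃ h : L.E → H →ₗ[Aᵐᵒᵖ]
      (({α : OmegaOne // α ∉ L.E} × ℕ) ⊕ (L.E × ℕ)) →₀ Aᵐᵒᵖ,
      ∀ δ, (δ ∈ D → ∀ n, ∀ i, h δ (T.b n i) =
          xValue T L α own h (⟨L.η δ n, L.η_notMem δ n⟩, i)) ∧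
        (δ ∈ D → ∀ q, h δ (s (k δ) q) = u δ q) ∧ (δ ∉ D → h δ = 0) := by
    have hstep : ∀ (δ : L.E) (h : L.E → H →ₗ[Aᵐᵒᵖ]
        (({α : OmegaOne // α ∉ L.E} × ℕ) ⊕ (L.E × ℕ)) →₀ Aᵐᵒᵖ),
        ∃ f : H →ₗ[Aᵐᵒᵖ] (({α : OmegaOne // α ∉ L.E} × ℕ) ⊕ (L.E × ℕ)) →₀ Aᵐᵒᵖ,
        (δ ∈ D → ∀ n < k δ, ∀ i, f (T.b n i) =
          xValue T L α own h (⟨L.η δ n, L.η_notMem δ n⟩, i)) ∧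
        (δ ∈ D → ∀ q, f (s (k δ) q) = u δ q) ∧ (δ ∉ D → f = 0) := by
      intro δ h
      by_cases hδ : δ ∈ D
      · obtain ⟨f, hf₁, hf₂⟩ := T.exists_linearMap (hs (k δ))
          (fun n i => xValue T L α own h (⟨L.η δ n, L.η_notMem δ n⟩, i)) (u δ)
        exact ⟨f, fun _ => hf₁, fun _ => hf₂, fun h => absurd hδ h⟩
      · exact ⟨0, fun h => absurd h hδ, fun h => absurd h hδ, fun _ => rfl⟩
    choose F hF₁ hF₂ hF₃ using hstep
    have hwf : WellFounded fun γ δ : L.E => e γ < e δ := (measure e).wf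
    let h := hwf.fix (C := fun _ => H →ₗ[Aᵐᵒᵖ]
      (({α : OmegaOne // α ∉ L.E} × ℕ) ⊕ (L.E × ℕ)) →₀ Aᵐᵒᵖ)
      fun δ ih => F δ fun γ => if hγ : e γ < e δ then ih γ hγ else 0
    have hfix : ∀ δ, h δ = F δ fun γ => if e γ < e δ then h γ else 0 := by
      intro δ
      have := hwf.fix_eq (C := fun _ => H →ₗ[Aᵐᵒᵖ]
        (({α : OmegaOne // α ∉ L.E} × ℕ) ⊕ (L.E × ℕ)) →₀ Aᵐᵒᵖ)
        (fun δ ih => F δ fun γ => if hγ : e γ < e δ then ih γ hγ else 0) δ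
      refine this.trans ?_
      congr 1
    refine ⟨h, fun δ => ⟨fun hδ n i => ?_, fun hδ q => ?_, fun hδ => ?_⟩⟩
    · rcases lt_or_ge n (k δ) with hn | hn
      · rw [hfix, hF₁ _ _ hδ n hn]
        simp only [xValue]
        split_ifs with hlt
        · rfl
        · rcases ho : own (L.η δ n) with _ | ⟨γ, m⟩
          · rfl
          · simp only [hearlier δ hδ n hn γ m ho, if_true]
      · simp only [xValue]
        rw [if_neg (not_lt.2 (hk₁ δ hδ n hn)), hown₁ δ hδ n hn]
    · rw [hfix, hF₂ _ _ hδ]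
    · rw [hfix, hF₃ _ _ hδ]
  let Φ : PreM A H L →ₗ[Aᵐᵒᵖ] (({α : OmegaOne // α ∉ L.E} × ℕ) ⊕ (L.E × ℕ)) →₀ Aᵐᵒᵖ :=
    (Finsupp.linearCombination Aᵐᵒᵖ (xValue T L α own h)).coprod (Finsupp.lsum ℕ h)
  have hΦ₁ : ∀ q, Φ (Finsupp.single q 1, 0) = xValue T L α own h q := by
    intro q
    simp [Φ]
  have hΦ₂ : ∀ δ x, Φ (0, Finsupp.single δ x) = h δ x := by
    intro δ x
    simp [Φ]
  have hlow : ∀ q : {α : OmegaOne // α ∉ L.E} × ℕ, q.1.1 < α → xValue T L α own h q = 0 := by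
    intro q hq
    rw [xValue, if_pos hq]
  have hcase : ∀ δ : L.E, δ.1 < β → δ.1 < α ∨ δ ∈ D := by
    intro δ hδ
    rcases lt_trichotomy δ.1 α with hlt | heq | hgt
    · exact Or.inl hlt
    · exact absurd (heq ▸ δ.2) hα
    · exact Or.inr ⟨hgt, hδ⟩
  have hnotD : ∀ δ : L.E, δ.1 < α → h δ = 0 := fun δ hδ =>
    (hh δ).2.2 fun hD => lt_asymm hδ hD.1
  have hrel : ∀ t : L.E × ℕ × ℕ, t.1.1 < β → Φ (relator T L t) = 0 := by
    rintro ⟨δ, n, i⟩ hδ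
    have : relator T L (δ, n, i) = (0, Finsupp.single δ (T.b n i)) -
        (Finsupp.single (⟨L.η δ n, L.η_notMem δ n⟩, i) 1, 0) := by
      simp [relator]
    rw [this, map_sub, hΦ₁, hΦ₂, sub_eq_zero]
    rcases hcase δ hδ with hlt | hD
    · rw [hnotD δ hlt, hlow _ ((L.η_lt δ n).trans hlt)]
      rfl
    · exact (hh δ).1 hD n i
  have hrels : ∀ p ∈ relations T L, (∀ δ : L.E, β ≤ δ.1 → p.2 δ = 0) → Φ p = 0 := by
    intro p hp hpβ
    rw [relations, ← Finsupp.range_linearCombination] at hp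
    obtain ⟨a, rfl⟩ := hp
    rw [Finsupp.linearCombination_apply, Finsupp.sum, map_sum]
    refine Finset.sum_eq_zero fun t ht => ?_
    rw [map_smul, hrel, smul_zero]
    by_contra hle
    exact (Finsupp.mem_support_iff.1 ht) (coeff_eq_zero T L a t.1 (hpβ t.1 (not_lt.1 hle)) t.2)
  have hΦα : ∀ p ∈ preStage A H L α, Φ p = 0 := fun p hp =>
    eqOn_preStage L (f := Φ) (g := 0) (fun q hq => by rw [hΦ₁, hlow q hq]; rfl)
      (fun δ hδ x => by rw [hΦ₂, hnotD δ hδ]; rfl) hp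
  -- A left inverse of the map induced by `Φ` on `M_β / M_α`.
  let Ψ : ((({α : OmegaOne // α ∉ L.E} × ℕ) ⊕ (L.E × ℕ)) →₀ Aᵐᵒᵖ) →ₗ[Aᵐᵒᵖ]
      GroupM T L ⧸ stage T L α :=
    Finsupp.linearCombination Aᵐᵒᵖ (Sum.elim
      (fun q => (stage T L α).mkQ (xElt T L q.1 q.2))
      fun t => (stage T L α).mkQ (theta T L t.1 (s (k t.1) (c (k t.1) t.2))))
  have hΨx : ∀ q : {α : OmegaOne // α ∉ L.E} × ℕ,
      (∀ δ n, own q.1.1 = some (δ, n) → ∀ i,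
        Ψ (h δ (T.b n i)) = (stage T L α).mkQ (theta T L δ (T.b n i))) →
      Ψ (xValue T L α own h q) = (stage T L α).mkQ (xElt T L q.1 q.2) := by
    rintro ⟨⟨γ, hγ⟩, i⟩ hq
    simp only [xValue]
    split_ifs with hlt
    · rw [map_zero, eq_comm, Submodule.mkQ_apply, Submodule.Quotient.mk_eq_zero]
      exact x_mem_stage T L _ _ hlt
    · rcases ho : own γ with _ | ⟨δ, n⟩
      · simp [Ψ]
      · obtain ⟨hδ, hn, rfl⟩ := hown₂ _ _ _ ho
        simp only
        rw [hq δ n ho, theta_b]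
  have hΨu : ∀ δ q, Ψ (u δ q) = (stage T L α).mkQ (theta T L δ (s (k δ) q)) := by
    intro δ q
    have : Ψ ∘ₗ u δ = (stage T L α).mkQ ∘ₗ theta T L δ ∘ₗ s (k δ) := by
      refine (c (k δ)).ext fun i => ?_
      simp [Ψ, u, Module.Basis.constr_basis]
    exact LinearMap.congr_fun this q
  have hΨθ : ∀ N, ∀ δ ∈ D, e δ = N → Ψ ∘ₗ h δ = (stage T L α).mkQ ∘ₗ theta T L δ := by
    intro N
    induction N using Nat.strong_induction_on with
    | _ N ih =>
      rintro δ hδ rfl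
      refine T.linearMap_ext (hs (k δ)) (fun n hn i => ?_) fun q => ?_
      · rw [LinearMap.comp_apply, LinearMap.comp_apply, (hh δ).1 hδ, theta_b]
        refine hΨx _ fun γ m ho i => ?_
        exact LinearMap.congr_fun
          (ih _ (hearlier δ hδ n hn γ m ho) γ (hown₂ _ _ _ ho).1 rfl) _
      · rw [LinearMap.comp_apply, LinearMap.comp_apply, (hh δ).2.1 hδ, hΨu]
  have hΨΦ : ∀ p ∈ preStage A H L β,
      Ψ (Φ p) = (stage T L α).mkQ ((relations T L).mkQ p) := by
    intro p hp
    refine eqOn_preStage L (f := Ψ ∘ₗ Φ) (g := (stage T L α).mkQ ∘ₗ (relations T L).mkQ)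
      (fun q hq => ?_) (fun δ hδ x => ?_) hp
    · rw [LinearMap.comp_apply, hΦ₁]
      exact hΨx q fun δ n ho i => LinearMap.congr_fun (hΨθ _ δ (hown₂ _ _ _ ho).1 rfl) _
    · rw [LinearMap.comp_apply, hΦ₂]
      rcases hcase δ hδ with hlt | hD
      · rw [hnotD δ hlt, LinearMap.zero_apply, map_zero, eq_comm, LinearMap.comp_apply,
          Submodule.mkQ_apply (stage T L α), Submodule.Quotient.mk_eq_zero]
        exact theta_mem_stage T L δ x hlt
      · exact LinearMap.congr_fun (hΨθ _ δ hD rfl) x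
  refine ⟨Φ, fun p hp => ⟨fun h0 => ?_, fun hmem => ?_⟩⟩
  · have := hΨΦ p hp
    rwa [h0, map_zero, eq_comm, Submodule.mkQ_apply (stage T L α),
      Submodule.Quotient.mk_eq_zero] at this
  · obtain ⟨p', hp', hr⟩ := (mkQ_mem_stage T L).1 hmem
    have h1 : Φ (p - p') = 0 := by
      refine hrels _ hr fun δ hδ => ?_
      rw [Prod.snd_sub, Finsupp.sub_apply, ((mem_preStage L).1 hp).2 δ hδ,
        ((mem_preStage L).1 hp').2 δ (hαβ.trans hδ), sub_zero]
    rwa [map_sub, hΦα p' hp', sub_zero] at h1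

end Quotients

/-! ### A criterion for algebraic closedness -/

section AlgClosed

/-- A criterion for algebraic closedness: finitely many elements of `S` can be related to elements
of `A` by a subring of `S × A` that relates `0` only to `0`, and each `f a` to `a`. -/
theorem isAlgClosedIn_of_subring {A S : Type*} [Ring A] [Ring S] (f : A →+* S)
    (h : ∀ (n : ℕ) (s : Fin n → S), ∃ R : Subring (S × A), (∀ a, (f a, a) ∈ R) ∧
      (∀ i, ∃ t, (s i, t) ∈ R) ∧ ∀ a, (0, a) ∈ R → a = 0) :
    IsAlgClosedIn f := by
  rintro n P ⟨s, hs⟩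
  obtain ⟨R, hf, hR, h0⟩ := h n s
  choose t ht using hR
  refine ⟨t, fun p hp => h0 _ ?_⟩
  rw [← hs p hp]
  clear hp
  induction p with
  | grade0 k =>
    rw [AlgHom.commutes, AlgHom.commutes, eq_intCast, eq_intCast]
    exact intCast_mem R k
  | grade1 x =>
    rw [FreeAlgebra.lift_ι_apply, FreeAlgebra.lift_ι_apply]
    cases x with
    | inl a => exact hf a
    | inr i => exact ht i
  | mul x y hx hy =>
    rw [map_mul, map_mul]
    exact mul_mem hx hy
  | add x y hx hy =>
    rw [map_add, map_add]
    exact add_mem hx hy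

end AlgClosed

/-! ### Endomorphisms of `M` and their action on `M_{δ+1} / M_δ` -/

section Endomorphisms

variable {r : ℕ} {G : Type*} [AddCommGroup G] [Module (CornerRing r)ᵐᵒᵖ G]
  {H : Type*} [AddCommGroup H] [Module (CornerRing r)ᵐᵒᵖ H]
  (T : Template (CornerRing r) H G) (L : LadderSystem)

/-- `Hom(G, M / M_α) = 0` if `α ∉ E`. -/
theorem addMonoidHom_quotient_stage_eq_zero (hr : 0 < r) [Countable G] [IsAddTorsionFree G]
    (hG : Function.Bijective (actionHom (CornerRing r) G)) {α : OmegaOne} (hα : α ∉ L.E)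
    (f : G →+ GroupM T L ⧸ stage T L α) : f = 0 := by
  choose m hm using fun g => (stage T L α).mkQ_surjective (f g)
  obtain ⟨β₀, hβ₀⟩ := exists_subset_stage T L m
  set β := max α β₀
  have hp : ∀ g, ∃ p ∈ preStage (CornerRing r) H L β, (relations T L).mkQ p = m g := fun g =>
    stage_mono T L (le_max_right α β₀) (hβ₀ g)
  choose p hp hpm using hp
  obtain ⟨Φ, hΦ⟩ := exists_linearMap_ker_eq_stage T L hα (le_max_left α β₀ : α ≤ β)
  have hadd : ∀ g g', Φ (p (g + g')) = Φ (p g) + Φ (p g') := by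
    intro g g'
    rw [← map_add, ← sub_eq_zero, ← map_sub, hΦ _ (sub_mem (hp _) (add_mem (hp _) (hp _))),
      ← Submodule.Quotient.mk_eq_zero, ← Submodule.mkQ_apply]
    simp only [map_sub, map_add, hpm, hm, sub_self]
  have h0 := addMonoidHom_finsupp_eq_zero hr hG (AddMonoidHom.mk' (fun g => Φ (p g)) hadd)
  ext g
  rw [← hm, ← hpm, Submodule.mkQ_apply (stage T L α), AddMonoidHom.zero_apply,
    Submodule.Quotient.mk_eq_zero, ← hΦ _ (hp g)]
  exact DFunLike.congr_fun h0 g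

/-- The quotient map `H → G`. -/
noncomputable def Template.toG {A : Type*} [Ring A] {H : Type*} [AddCommGroup H] [Module Aᵐᵒᵖ H]
    {G : Type*} [AddCommGroup G] [Module Aᵐᵒᵖ G] (T : Template A H G) : H →ₗ[Aᵐᵒᵖ] G :=
  T.iso.toLinearMap ∘ₗ T.B.mkQ

theorem Template.toG_surjective : Function.Surjective T.toG :=
  T.iso.surjective.comp T.B.mkQ_surjective

theorem Template.toG_eq_zero {h : H} : T.toG h = 0 ↔ h ∈ T.B := by
  rw [← Submodule.Quotient.mk_eq_zero]
  exact T.iso.map_eq_zero_iff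

/-- An endomorphism of `M` that maps `M_δ` to itself induces an endomorphism of
`M_{δ+1} / M_δ ≅ G`, that is, it acts on `M_{δ+1} / M_δ` as an element of `A`: it maps `M_{δ+1}` to
itself as `Hom(G, M / M_{δ+1}) = 0`. -/
theorem exists_sub_smul_mem_stage (hr : 0 < r) [Countable G] [IsAddTorsionFree G]
    (hG : Function.Bijective (actionHom (CornerRing r) G)) (δ : L.E)
    (s : AddMonoid.End (GroupM T L)) (hs : ∀ m ∈ stage T L δ.1, s m ∈ stage T L δ.1) :
    ∃ a : CornerRing r, ∀ h, s (theta T L δ h) - MulOpposite.op a • theta T L δ h ∈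
      stage T L δ.1 := by
  -- the successor `α` of `δ` is not in `E`
  obtain ⟨α, hα⟩ : ∃ α : OmegaOne, ∀ γ, γ < α ↔ γ ≤ δ.1 := by
    have hne : {γ | δ.1 < γ}.Nonempty := exists_gt δ.1
    exact ⟨wellFounded_lt.min _ hne, fun γ =>
      ⟨fun h => not_lt.1 fun hγ => wellFounded_lt.not_lt_min _ hγ h,
        fun h => h.trans_lt (wellFounded_lt.min_mem _ hne)⟩⟩
  have hαE : α ∉ L.E := fun h => (L.limit α h).isSuccPrelimit δ.1
    ⟨(hα _).2 le_rfl, fun γ hγ hγα => absurd ((hα γ).1 hγα) (not_le.2 hγ)⟩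
  have hB : ∀ h, T.toG h = 0 → s (theta T L δ h) ∈ stage T L δ.1 := by
    intro h hh
    rw [T.toG_eq_zero, ← comap_theta_stage T L δ] at hh
    exact hs _ hh
  choose q hq using T.toG_surjective
  -- `f` is the map `G ≅ M_{δ+1} / M_δ → M / M_δ` induced by `s`
  have hadd : ∀ h h', T.toG h = T.toG h' →
      s (theta T L δ h) - s (theta T L δ h') ∈ stage T L δ.1 := by
    intro h h' hh
    rw [← map_sub, ← map_sub]
    exact hB _ (by rw [map_sub, hh, sub_self])
  let f : G →+ GroupM T L ⧸ stage T L δ.1 := AddMonoidHom.mk'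
    (fun g => (stage T L δ.1).mkQ (s (theta T L δ (q g)))) (by
      intro g g'
      rw [← map_add, ← map_add, ← map_add, ← sub_eq_zero, ← map_sub, Submodule.mkQ_apply,
        Submodule.Quotient.mk_eq_zero]
      exact hadd _ _ (by rw [map_add, hq, hq, hq]))
  have hle : stage T L δ.1 ≤ stage T L α := stage_mono T L ((hα _).2 le_rfl).le
  have hf0 := addMonoidHom_quotient_stage_eq_zero T L hr hG hαE
    ((Submodule.factor hle).toAddMonoidHom.comp f)
  have hmem : ∀ g, ∃ h, s (theta T L δ (q g)) - theta T L δ h ∈ stage T L δ.1 := by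
    intro g
    have h1 : s (theta T L δ (q g)) ∈ stage T L α := by
      rw [← Submodule.Quotient.mk_eq_zero]
      exact DFunLike.congr_fun hf0 g
    rw [stage_succ_of_mem T L δ hα] at h1
    obtain ⟨y, hy, _, ⟨h, rfl⟩, hyz⟩ := Submodule.mem_sup.1 h1
    exact ⟨h, by rwa [← hyz, add_sub_cancel_right]⟩
  choose w hw using hmem
  have hw' : ∀ h h', theta T L δ h - theta T L δ h' ∈ stage T L δ.1 → T.toG h = T.toG h' := by
    intro h h' hh
    rw [← sub_eq_zero, ← map_sub, T.toG_eq_zero, ← comap_theta_stage T L δ, Submodule.mem_comap,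
      map_sub]
    exact hh
  obtain ⟨a, ha⟩ := exists_actionHom_eq hG (AddMonoidHom.mk' (fun g => T.toG (w g)) (by
    intro g g'
    rw [← map_add]
    apply hw'
    have h1 := hadd (q (g + g')) (q g + q g') (by rw [map_add, hq, hq, hq])
    rw [map_add, map_add] at h1
    have h2 := sub_mem (add_mem (add_mem (hw g) (hw g')) h1) (hw (g + g'))
    rw [map_add]
    convert h2 using 1
    abel))
  refine ⟨a, fun h => ?_⟩
  have h1 : T.toG (w (T.toG h) - MulOpposite.op a • h) = 0 := by
    rw [map_sub, map_smul, ← ha]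
    exact sub_self _
  rw [T.toG_eq_zero, ← comap_theta_stage T L δ, Submodule.mem_comap, map_sub, map_smul] at h1
  have h2 := add_mem (add_mem h1 (hw (T.toG h))) (hadd h (q (T.toG h)) (hq _).symm)
  convert h2 using 1
  abel

/-- The pairs of an endomorphism of `M` and an element of `A` such that the endomorphism maps `M_δ`
to itself and both act in the same way on `M_{δ+1} / M_δ`. -/
noncomputable def actsAs (δ : L.E) :
    Subring ((AddMonoid.End (GroupM T L))ᵐᵒᵖ × CornerRing r) where
  carrier := {x | (∀ m ∈ stage T L δ.1, x.1.unop m ∈ stage T L δ.1) ∧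
    ∀ h, x.1.unop (theta T L δ h) - MulOpposite.op x.2 • theta T L δ h ∈ stage T L δ.1}
  mul_mem' := by
    rintro ⟨s, a⟩ ⟨t, b⟩ ⟨hs, hs'⟩ ⟨ht, ht'⟩
    refine ⟨fun m hm => ht _ (hs m hm), fun h => ?_⟩
    have h1 := add_mem (ht _ (hs' h)) (ht' (MulOpposite.op a • h))
    rw [map_smul, map_sub, sub_add_sub_cancel, ← mul_smul, ← MulOpposite.op_mul] at h1
    exact h1
  one_mem' := ⟨fun m hm => hm, fun h => by simp⟩
  add_mem' := by
    rintro ⟨s, a⟩ ⟨t, b⟩ ⟨hs, hs'⟩ ⟨ht, ht'⟩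
    refine ⟨fun m hm => add_mem (hs m hm) (ht m hm), fun h => ?_⟩
    have h1 := add_mem (hs' h) (ht' h)
    rw [sub_add_sub_comm, ← add_smul, ← MulOpposite.op_add] at h1
    exact h1
  zero_mem' := ⟨fun m hm => zero_mem _, fun h => by simp⟩
  neg_mem' := by
    rintro ⟨s, a⟩ ⟨hs, hs'⟩
    refine ⟨fun m hm => neg_mem (hs m hm), fun h => ?_⟩
    have h1 := neg_mem (hs' h)
    rw [neg_sub', ← neg_smul, ← MulOpposite.op_neg] at h1
    exact h1

theorem actionHom_mem_actsAs (δ : L.E) (a : CornerRing r) :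
    (actionHom (CornerRing r) (GroupM T L) a, a) ∈ actsAs T L δ :=
  ⟨fun m hm => Submodule.smul_mem _ _ hm, fun h => by
    rw [actionHom_apply, sub_self]
    exact zero_mem _⟩

/-- An element of `A` acting as zero on `M_{δ+1} / M_δ ≅ G` is zero. -/
theorem eq_zero_of_zero_actsAs (hG : Function.Bijective (actionHom (CornerRing r) G)) (δ : L.E)
    {a : CornerRing r} (ha : (0, a) ∈ actsAs T L δ) : a = 0 := by
  apply hG.1
  rw [map_zero]
  apply MulOpposite.unop_injective
  ext g
  obtain ⟨h, rfl⟩ := T.toG_surjective g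
  rw [actionHom_apply, ← map_smul]
  change _ = (0 : G)
  rw [T.toG_eq_zero, ← comap_theta_stage T L δ, Submodule.mem_comap, map_smul]
  have := neg_mem (ha.2 h)
  simpa using this

end Endomorphisms

end KaplanskyTest

theorem proposition3p2 (r : ℕ) (hr : 0 < r)
    {G : Type*} [AddCommGroup G] [Module (KaplanskyTest.CornerRing r)ᵐᵒᵖ G]
    [Countable G] [IsAddTorsionFree G]
    (hG : Function.Bijective (KaplanskyTest.actionHom (KaplanskyTest.CornerRing r) G))
    {H : Type*} [AddCommGroup H] [Module (KaplanskyTest.CornerRing r)ᵐᵒᵖ H]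
    (T : KaplanskyTest.Template (KaplanskyTest.CornerRing r) H G)
    (L : KaplanskyTest.LadderSystem) :
    KaplanskyTest.IsAlgClosedIn
      (KaplanskyTest.actionHom (KaplanskyTest.CornerRing r) (KaplanskyTest.GroupM T L)) := by
  refine KaplanskyTest.isAlgClosedIn_of_subring _ fun n s => ?_
  obtain ⟨δ, hδ⟩ := KaplanskyTest.exists_stage_invariant T L fun i => (s i).unop
  refine ⟨KaplanskyTest.actsAs T L δ, KaplanskyTest.actionHom_mem_actsAs T L δ, fun i => ?_,
    fun a => KaplanskyTest.eq_zero_of_zero_actsAs T L hG δ⟩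
  obtain ⟨t, ht⟩ := KaplanskyTest.exists_sub_smul_mem_stage T L hr hG δ (s i).unop (hδ i)
  exact ⟨t, hδ i, ht⟩
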